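/- **Setting.** Let $K\ge 8$ be the number of arms and $[K]=\{1,\dots,K\}$. In an environment with gap matrix $\boldsymbol\Delta$, a duel of the pair $(i,j)$ returns an independent Bernoulli variable of parameter $\tfrac12+\Delta_{i,j}$ (equal to $1$ if $i$ wins). Let $\mathbb D_{\mathrm{cw}}$ be the set of matrices $\boldsymbol\Delta\in[-\tfrac14,\tfrac14]^{K\times K}$ with $\boldsymbol\Delta=-\boldsymbol\Delta^{T}$ that admit a Condorcet winner (CW), i.e. a (necessarily unique) arm $i^*=i^*_{\boldsymbol\Delta}$ with $\Delta_{i^*,j}>0$ for all $j\ne i^*$. An algorithm $A$ (possibly randomized) chooses, given the past observations, either a pair $(i,j)\in[K]^2$ to duel, or to stop and recommend an arm $\hat i$. Let $N_\delta\in\mathbb N\cup\{\infty\}$ be its total number of duels and $\mathbb P_{\boldsymbol\Delta,A}$ the law of its interaction with $\boldsymbol\Delta$. It is $\delta$-correct if $\mathbb P_{\boldsymbol\Delta,A}(A\text{ stops and }\hat i\neq i^*_{\boldsymbol\Delta})\le\delta$ for every $\boldsymbol\Delta\in\mathbb D_{\mathrm{cw}}$. For $\boldsymbol\Delta\in\mathbb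 D_{\mathrm{cw}}$ and $i\neq i^*$ let $K_{i;<0}=|\{j:\Delta_{i,j}<0\}|$ and let $\Delta_{i,(s)}$ be the $s$-th smallest entry of row $i$. For $\boldsymbol s=(s_i)_{i\ne i^*}$ with integers $1\le s_i\le K_{i;<0}\wedge K/8$ set $$H_{\mathrm{certify}}(\boldsymbol s,\delta)=\sum_{i\ne i^*}\frac{\log(1/\delta)}{\Delta_{i,(s_i)}^2},\qquad H_{\mathrm{explore}}(\boldsymbol s,\delta)=\max_{i\ne i^*}\frac{K\log(1/\delta)}{s_i\Delta_{i,(s_i)}^2}+\sum_{i\ne i^*}\frac{K}{s_i\Delta_{i,(s_i)}^2}.$$ The effective sparsity $\boldsymbol s^*_{\boldsymbol\Delta}$ (which depends on $\delta$) is a vector minimizing $H_{\mathrm{certify}}(\boldsymbol s,\delta)+H_{\mathrm{explore}}(\boldsymbol s,\delta)$ over these $\boldsymbol s$; ties between minimizers are broken by an arbitrary fixed rule. Let $$\mathbb D(\boldsymbol\Delta)=\bigl\{\tilde{\boldsymbol\Delta}\in\mathbb D_{\mathrm{cw}}:\ i^*_{\tilde{\boldsymbol\Delta}}=i^*_{\boldsymbol\Delta},\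 \boldsymbol s^*_{\tilde{\boldsymbol\Delta}}=\boldsymbol s^*_{\boldsymbol\Delta},\ \tilde\Delta_{i,(s^*_i)}=\Delta_{i,(s^*_i)}\ \text{for all } i\ne i^*\bigr\},\qquad \boldsymbol s^*=\boldsymbol s^*_{\boldsymbol\Delta}.$$ **Statement.** There is a numerical constant $c>0$ such that for every $K\ge 8$, every $\delta\in(0,1/12]$, every tie-breaking rule in the definition of $\boldsymbol s^*$, every $\delta$-correct algorithm $A$ and every $\boldsymbol\Delta\in\mathbb D_{\mathrm{cw}}$, there is $\tilde{\boldsymbol\Delta}\in\mathbb D(\boldsymbol\Delta)$ with $$\mathbb P_{\tilde{\boldsymbol\Delta},A}\Bigl(N_\delta\ \ge\ \frac{c}{\log K}\bigl(H_{\mathrm{certify}}(\boldsymbol s^*,\delta)+H_{\mathrm{explore}}(\boldsymbol s^*,\delta)\bigr)\Bigr)\ \ge\ \delta ,$$ where $H_{\mathrm{certify}}$ and $H_{\mathrm{explore}}$ are computed from $\boldsymbol\Delta$ (equivalently, from $\tilde{\boldsymbol\Delta}$). -/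

import Mathlib

open MeasureTheory ProbabilityTheory
open scoped ENNReal

namespace CondorcetWinner

/-! ### Gap matrices -/

/-- `i` is the Condorcet winner of `Δ`: all the off-diagonal entries of its row are positive.
For a skew-symmetric `Δ` there is at most one such arm. -/
def IsCW {K : ℕ} (Δ : Matrix (Fin K) (Fin K) ℝ) (i : Fin K) : Prop :=
  ∀ j, j ≠ i → 0 < Δ i j

/-- The class of skew-symmetric gap matrices with entries in `[-1/4, 1/4]` which admit a
Condorcet winner. -/
def Dcw (K : ℕ) : Set (Matrix (Fin K) (Fin K) ℝ) :=
  {Δ | (∀ i j, Δ i j ∈ Set.Icc (-(1 / 4) : ℝ) (1 / 4)) ∧ Δ = -Δ.transpose ∧ ∃ i, IsCW Δ i}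

/-- The number of negative entries in row `i`. -/
noncomputable def numNeg {K : ℕ} (Δ : Matrix (Fin K) (Fin K) ℝ) (i : Fin K) : ℕ :=
  Set.ncard {j | Δ i j < 0}

/-- The `s`-th smallest entry of row `i`, counted with multiplicity, for `1 ≤ s ≤ K`:
the least `x` such that at least `s` entries of the row are at most `x`. -/
noncomputable def orderedGap {K : ℕ} (Δ : Matrix (Fin K) (Fin K) ℝ) (i : Fin K) (s : ℕ) : ℝ :=
  sInf {x : ℝ | s ≤ Set.ncard {j | Δ i j ≤ x}}

/-- The certification cost at sparsity `s`, where `i₀` is the Condorcet winner. -/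
noncomputable def Hcertify {K : ℕ} (Δ : Matrix (Fin K) (Fin K) ℝ) (i₀ : Fin K) (s : Fin K → ℕ)
    (δ : ℝ) : ℝ :=
  ∑ i : {i : Fin K // i ≠ i₀}, Real.log (1 / δ) / orderedGap Δ i (s i) ^ 2

/-- The exploration cost at sparsity `s`, where `i₀` is the Condorcet winner. -/
noncomputable def Hexplore {K : ℕ} (Δ : Matrix (Fin K) (Fin K) ℝ) (i₀ : Fin K) (s : Fin K → ℕ)
    (δ : ℝ) : ℝ :=
  (⨆ i : {i : Fin K // i ≠ i₀}, K * Real.log (1 / δ) / (s i * orderedGap Δ i (s i) ^ 2)) +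
    ∑ i : {i : Fin K // i ≠ i₀}, K / (s i * orderedGap Δ i (s i) ^ 2)

/-- Admissible sparsity vectors: `1 ≤ s i ≤ min (numNeg Δ i) (K / 8)` for every `i ≠ i₀`
(the coordinate at `i₀` is irrelevant). -/
def IsAdmissible {K : ℕ} (Δ : Matrix (Fin K) (Fin K) ℝ) (i₀ : Fin K) (s : Fin K → ℕ) : Prop :=
  ∀ i, i ≠ i₀ → 1 ≤ s i ∧ s i ≤ numNeg Δ i ∧ (s i : ℝ) ≤ (K : ℝ) / 8

/-- `s` achieves the minimum of `Hcertify + Hexplore` over the admissible sparsity vectors. -/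
def IsOptimalSparsity {K : ℕ} (δ : ℝ) (Δ : Matrix (Fin K) (Fin K) ℝ) (i₀ : Fin K)
    (s : Fin K → ℕ) : Prop :=
  IsAdmissible Δ i₀ s ∧ ∀ t, IsAdmissible Δ i₀ t →
    Hcertify Δ i₀ s δ + Hexplore Δ i₀ s δ ≤ Hcertify Δ i₀ t δ + Hexplore Δ i₀ t δ

/-- `sStar` is an effective sparsity map: it selects, for every gap matrix of `Dcw K`, a vector
which achieves the minimum. (The minimizer need not be unique, so that such a map amounts to a
rule for breaking ties.) -/
def IsEffectiveSparsity {K : ℕ} (δ : ℝ) (sStar : Matrix (Fin K) (Fin K) ℝ → Fin K → ℕ) : Prop :=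
  ∀ Δ ∈ Dcw K, ∀ i₀, IsCW Δ i₀ → IsOptimalSparsity δ Δ i₀ (sStar Δ)

/-- The gap matrices in `Dcw K` with the same Condorcet winner `i₀`, the same effective sparsity
and the same gaps at the effective sparsity as `Δ`. -/
def localClass {K : ℕ} (sStar : Matrix (Fin K) (Fin K) ℝ → Fin K → ℕ)
    (Δ : Matrix (Fin K) (Fin K) ℝ) (i₀ : Fin K) : Set (Matrix (Fin K) (Fin K) ℝ) :=
  {Δ' | Δ' ∈ Dcw K ∧ IsCW Δ' i₀ ∧
    (∀ i, i ≠ i₀ → sStar Δ' i = sStar Δ i) ∧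
    ∀ i, i ≠ i₀ → orderedGap Δ' i (sStar Δ i) = orderedGap Δ i (sStar Δ i)}

/-! ### Algorithms and their interaction with an environment -/

/-- A decision: either query a duel, or stop and recommend an arm. -/
inductive Action (K : ℕ) : Type
  | duel (i j : Fin K) : Action K
  | recommend (i : Fin K) : Action K

/-- The duels observed so far, the most recent one first: `(i, j, b)` is a duel of the pair
`(i, j)`, and `b` tells whether `i` won it. -/
abbrev History (K : ℕ) : Type := List (Fin K × Fin K × Bool)

/-- A (randomized, sequential, adaptive) algorithm: the conditional distribution of the next
decision given the past observations. -/
structure Algorithm (K : ℕ) : Type where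
  policy : History K → PMF (Action K)

/-- The state of a run: the observations so far, and the recommendation if it has stopped. -/
structure State (K : ℕ) : Type where
  history : History K
  output : Option (Fin K)

instance (K : ℕ) : MeasurableSpace (State K) := ⊤

instance (K : ℕ) : DiscreteMeasurableSpace (State K) := ⟨fun _ => trivial⟩

/-- The probability `1/2 + Δ i j` that `i` wins a duel of `(i, j)`. The projection onto `[0, 1]`
has no effect when `|Δ i j| ≤ 1/2`. -/
noncomputable def winProb {K : ℕ} (Δ : Matrix (Fin K) (Fin K) ℝ) (i j : Fin K) : ℝ :=
  Set.projIcc (0 : ℝ) 1 zero_le_one (1 / 2 + Δ i j)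

/-- The Bernoulli outcome of a duel of `(i, j)`. -/
noncomputable def outcome {K : ℕ} (Δ : Matrix (Fin K) (Fin K) ℝ) (i j : Fin K) : PMF Bool :=
  PMF.ofFintype
    (fun b => if b then ENNReal.ofReal (winProb Δ i j) else ENNReal.ofReal (1 - winProb Δ i j))
    (by
      have h0 : 0 ≤ winProb Δ i j := (Set.projIcc (0 : ℝ) 1 zero_le_one _).2.1
      have h1 : winProb Δ i j ≤ 1 := (Set.projIcc (0 : ℝ) 1 zero_le_one _).2.2
      rw [Fintype.sum_bool]
      simp only [if_true, Bool.false_eq_true, if_false]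
      rw [← ENNReal.ofReal_add h0 (by linarith)]
      simp)

/-- One step of the interaction between the algorithm `A` and the environment `Δ`. -/
noncomputable def transition {K : ℕ} (A : Algorithm K) (Δ : Matrix (Fin K) (Fin K) ℝ) :
    State K → PMF (State K)
  | ⟨h, some i⟩ => PMF.pure ⟨h, some i⟩
  | ⟨h, none⟩ => (A.policy h).bind fun a =>
      match a with
      | Action.recommend i => PMF.pure ⟨h, some i⟩
      | Action.duel i j => (outcome Δ i j).map fun b => ⟨(i, j, b) :: h, none⟩

/-- `transition` as a Markov kernel. -/
noncomputable def stepKernel {K : ℕ} (A : Algorithm K) (Δ : Matrix (Fin K) (Fin K) ℝ) :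
    Kernel (State K) (State K) where
  toFun x := (transition A Δ x).toMeasure
  measurable' := measurable_from_top

instance {K : ℕ} (A : Algorithm K) (Δ : Matrix (Fin K) (Fin K) ℝ) :
    IsMarkovKernel (stepKernel A Δ) :=
  ⟨fun x => PMF.toMeasure.isProbabilityMeasure (transition A Δ x)⟩

/-- The law of the whole run of the algorithm `A` in the environment `Δ`: the law of the Markov
chain with transitions `transition A Δ` which starts with no observation. -/
noncomputable def law {K : ℕ} (A : Algorithm K) (Δ : Matrix (Fin K) (Fin K) ℝ) :
    Measure (ℕ → State K) :=
  Kernel.trajMeasure (X := fun _ => State K) (Measure.dirac ⟨[], none⟩)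
    (fun n => (stepKernel A Δ).comap
      (fun x : (i : Finset.Iic n) → State K => x ⟨n, Finset.mem_Iic.2 le_rfl⟩)
      (measurable_pi_apply _))

/-- The budget: the total number of duels of the run (`⊤` if it never stops). -/
noncomputable def budget {K : ℕ} (ω : ℕ → State K) : ℕ∞ :=
  ⨆ n, ((ω n).history.length : ℕ∞)

/-- The run stops and recommends the arm `i`. -/
def Returns {K : ℕ} (ω : ℕ → State K) (i : Fin K) : Prop :=
  ∃ n, (ω n).output = some i

/-- `δ`-correctness over `Dcw K`: whatever the environment, the probability of recommending an
arm which is not the Condorcet winner is at most `δ`. (A run that never stops is not counted as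
an error, which only enlarges the class of algorithms.) -/
def Algorithm.IsCorrect {K : ℕ} (A : Algorithm K) (δ : ℝ) : Prop :=
  ∀ Δ ∈ Dcw K, ∀ i₀, IsCW Δ i₀ →
    law A Δ {ω | ∃ i, i ≠ i₀ ∧ Returns ω i} ≤ ENNReal.ofReal δ

end CondorcetWinner

/-!
The lower bound is proved by a change of measure between hard environments of the local class of
`Δ` and modifications of them which have another Condorcet winner. It holds even without the factor
`1 / log K`.

**Hard environments.** Let `s` be the effective sparsity of `Δ` and let `-g i` be the gap of row `i`
at `s i`. The arms other than the Condorcet winner `i₀` are put on a cycle of length `K - 1`, and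
each of them points to its `m = ⌊(K - 2) / 2⌋` successors, so that no two arms point to each other.
In `env`, the arm `i` loses by `g i` against exactly `s i` of these successors, a cyclic interval of
labels with a hidden position `σ i`; the arm `i₀` beats everyone by a tiny margin `ε`; all other gaps
vanish. Then `s` is the *only* minimizer of the cost of `env` (`eq_of_isOptimalSparsity_env`), since
a larger coordinate would pay `1 / ε ^ 2`, while a smaller one leaves the gap unchanged and increases
the exploration cost. So `env` lies in the local class, whatever the rule for breaking ties. The
margin `ε` cannot be replaced by `g i`, since otherwise duels against `i₀` would reveal a negative
entry of each row for free. In `altEnv`, the arm `i` is made the Condorcet winner by lifting its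
nonpositive entries to `ε`; this environment does not depend on the position `σ i`.

**Change of measure.** The expectation of a function of the state after `n` steps is a finite sum,
encoded as the `n`-th power of a one-step operator. An induction on `n` gives the Donsker–Varadhan
inequality between two environments (`expect_log_le`), hence `prob_mul_log_le`: for an event `S` and
`r ≥ 1`, `P₁(S) log r ≤ KL + (r - 1) P₂(S)`, where `KL` is the expected number of duels of each pair
weighted by its relative entropy. Between `env` and `altEnv` only the duels of `i` against the arms
which beat it matter, with a weight of order `g i ^ 2`; for different `i` these pairs are disjoint.

**Three bounds.** Suppose that in all the environments `env` the budget is below `θ` with probability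
more than `1 - δ`, and let `B = ⌈θ⌉`. At time `B` the arm `i₀` has then been recommended with
probability at least `1 - 2δ` in `env`, and at most `δ` in `altEnv`.
* Changing `env` into `altEnv` shows that `log (1 / δ) / g i ^ 2` duels are spent on each arm `i`
  (`log_div_sq_le_mean`); summing over `i` bounds `Hcertify`.
* Changing `altEnv` into `env` and averaging over the position `σ i`, a duel carries information only
  with probability `s i / m`. This bounds the maximum in `Hexplore` (`explore_log_le`).
* The same change of measure, for the algorithm stopped as soon as it has spent about
  `K / (s i g i ^ 2)` duels on `i`, shows that this number is exceeded with constant probability in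
  `env`, on average over `σ i` (`sum_prob_lt_weight_ge`). Averaging over the whole vector `σ` and
  summing over `i` bounds the sum in `Hexplore` (`explore_sum_le`).

All three quantities are thus at most a constant times `B`, which contradicts the choice of `θ`.
-/

/-! ### Expectations along a run -/

namespace CondorcetWinner

/-- Actions are either pairs of arms or single arms. -/
def actionEquiv (K : ℕ) : Action K ≃ (Fin K × Fin K) ⊕ Fin K where
  toFun
    | .duel i j => Sum.inl (i, j)
    | .recommend i => Sum.inr i
  invFun
    | Sum.inl p => .duel p.1 p.2
    | Sum.inr i => .recommend i
  left_inv a := by cases a <;> rfl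
  right_inv a := by rcases a with ⟨i, j⟩ | i <;> rfl

noncomputable instance (K : ℕ) : Fintype (Action K) := Fintype.ofEquiv _ (actionEquiv K).symm

/-- The mean of `g` at the next state, when the action `a` is taken after the observations `h`. -/
noncomputable def actionValue {K : ℕ} (Δ : Matrix (Fin K) (Fin K) ℝ) (g : State K → ℝ)
    (h : History K) : Action K → ℝ
  | .duel i j => winProb Δ i j * g ⟨(i, j, true) :: h, none⟩ +
      (1 - winProb Δ i j) * g ⟨(i, j, false) :: h, none⟩
  | .recommend i => g ⟨h, some i⟩

/-- The one-step expectation operator of the chain with transitions `transition A Δ`, acting on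
real functions of the state. -/
noncomputable def step {K : ℕ} (A : Algorithm K) (Δ : Matrix (Fin K) (Fin K) ℝ) :
    Module.End ℝ (State K → ℝ) where
  toFun g x :=
    match x with
    | ⟨h, some i⟩ => g ⟨h, some i⟩
    | ⟨h, none⟩ => ∑ a, (A.policy h a).toReal * actionValue Δ g h a
  map_add' f g := by
    ext ⟨h, _ | i⟩
    · simp only [Pi.add_apply, ← Finset.sum_add_distrib, ← mul_add]
      refine Finset.sum_congr rfl fun a _ => ?_
      cases a <;> simp only [actionValue, Pi.add_apply]
      ring
    · rfl
  map_smul' c f := by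
    ext ⟨h, _ | i⟩
    · simp only [Pi.smul_apply, smul_eq_mul, RingHom.id_apply, Finset.mul_sum]
      refine Finset.sum_congr rfl fun a _ => ?_
      cases a <;> simp only [actionValue, Pi.smul_apply, smul_eq_mul] <;> ring
    · rfl

/-- The operator which sends `f` to the expectation of `f` after `n` steps, as a function of the
current state. -/
noncomputable def expect {K : ℕ} (A : Algorithm K) (Δ : Matrix (Fin K) (Fin K) ℝ) (n : ℕ) :
    Module.End ℝ (State K → ℝ) := step A Δ ^ n

section Operator

variable {K : ℕ} (A : Algorithm K) (Δ : Matrix (Fin K) (Fin K) ℝ)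

@[simp] lemma step_some (g : State K → ℝ) (h : History K) (i : Fin K) :
    step A Δ g ⟨h, some i⟩ = g ⟨h, some i⟩ := rfl

lemma step_none (g : State K → ℝ) (h : History K) :
    step A Δ g ⟨h, none⟩ = ∑ a, (A.policy h a).toReal * actionValue Δ g h a := rfl

@[simp] lemma expect_zero (f : State K → ℝ) : expect A Δ 0 f = f := rfl

lemma expect_succ (n : ℕ) (f : State K → ℝ) :
    expect A Δ (n + 1) f = step A Δ (expect A Δ n f) := by
  rw [expect, pow_succ']; rfl

lemma expect_succ' (n : ℕ) (f : State K → ℝ) :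
    expect A Δ (n + 1) f = expect A Δ n (step A Δ f) := by
  rw [expect, pow_succ]; rfl

@[simp] lemma expect_some (n : ℕ) (f : State K → ℝ) (h : History K) (i : Fin K) :
    expect A Δ n f ⟨h, some i⟩ = f ⟨h, some i⟩ := by
  induction n with
  | zero => rfl
  | succ n ih => rw [expect_succ, step_some, ih]

lemma expect_succ_none (n : ℕ) (f : State K → ℝ) (h : History K) :
    expect A Δ (n + 1) f ⟨h, none⟩ =
      ∑ a, (A.policy h a).toReal * actionValue Δ (expect A Δ n f) h a := by
  rw [expect_succ, step_none]

lemma winProb_nonneg (i j : Fin K) : 0 ≤ winProb Δ i j :=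
  (Set.projIcc (0 : ℝ) 1 zero_le_one _).2.1

lemma winProb_le_one (i j : Fin K) : winProb Δ i j ≤ 1 :=
  (Set.projIcc (0 : ℝ) 1 zero_le_one _).2.2

lemma sum_policy (h : History K) : ∑ a, (A.policy h a).toReal = 1 := by
  rw [← ENNReal.toReal_sum (fun a _ => PMF.apply_ne_top _ a), ← tsum_fintype (L := .unconditional _),
    PMF.tsum_coe, ENNReal.toReal_one]

/-- Monotonicity of `expect`, where the functions only have to be compared on states which satisfy
an invariant `R` of the run. -/
lemma expect_mono_on (R : ℕ → State K → Prop)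
    (hout : ∀ k h i, R k ⟨h, some i⟩ → R (k + 1) ⟨h, some i⟩)
    (hrec : ∀ k h i, A.policy h (.recommend i) ≠ 0 → R k ⟨h, none⟩ → R (k + 1) ⟨h, some i⟩)
    (hduel : ∀ k h i j b, A.policy h (.duel i j) ≠ 0 → R k ⟨h, none⟩ →
      R (k + 1) ⟨(i, j, b) :: h, none⟩)
    {f g : State K → ℝ} (n : ℕ) {k : ℕ} (hfg : ∀ y, R (k + n) y → f y ≤ g y)
    {x : State K} (hx : R k x) : expect A Δ n f x ≤ expect A Δ n g x := by
  induction n generalizing k x with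
  | zero => exact hfg x hx
  | succ n ih =>
    have ih' : ∀ x, R (k + 1) x → expect A Δ n f x ≤ expect A Δ n g x := fun x hx =>
      ih (fun y hy => hfg y (by rwa [show k + (n + 1) = k + 1 + n by ring])) hx
    rcases x with ⟨h, _ | i⟩
    · rw [expect_succ_none, expect_succ_none]
      refine Finset.sum_le_sum fun a _ => ?_
      by_cases ha : A.policy h a = 0
      · simp [ha]
      refine mul_le_mul_of_nonneg_left ?_ ENNReal.toReal_nonneg
      cases a with
      | recommend i => exact ih' _ (hrec k h i ha hx)
      | duel i j =>
        exact add_le_add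
          (mul_le_mul_of_nonneg_left (ih' _ (hduel k h i j _ ha hx)) (winProb_nonneg Δ i j))
          (mul_le_mul_of_nonneg_left (ih' _ (hduel k h i j _ ha hx))
            (sub_nonneg.2 (winProb_le_one Δ i j)))
    · rw [expect_succ, expect_succ, step_some, step_some]
      exact ih' _ (hout k h i hx)

lemma expect_mono {f g : State K → ℝ} (hfg : ∀ y, f y ≤ g y) (n : ℕ) (x : State K) :
    expect A Δ n f x ≤ expect A Δ n g x :=
  expect_mono_on A Δ (fun _ _ => True) (by simp) (by simp) (by simp) (k := 0) n
    (fun y _ => hfg y) trivial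

@[simp] lemma expect_const (c : ℝ) (n : ℕ) (x : State K) : expect A Δ n (fun _ => c) x = c := by
  induction n generalizing x with
  | zero => rfl
  | succ n ih =>
    rcases x with ⟨h, _ | i⟩
    · rw [expect_succ_none]
      have : ∀ a, actionValue Δ (expect A Δ n fun _ => c) h a = c := by
        intro a
        cases a <;> simp only [actionValue, ih]
        ring
      simp only [this, ← Finset.sum_mul, sum_policy, one_mul]
    · simp

lemma expect_pos {f : State K → ℝ} (hf : ∀ y, 0 < f y) (n : ℕ) (x : State K) :
    0 < expect A Δ n f x := by
  induction n generalizing x with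
  | zero => exact hf x
  | succ n ih =>
    rcases x with ⟨h, _ | i⟩
    · rw [expect_succ_none]
      have hv : ∀ a, 0 < actionValue Δ (expect A Δ n f) h a := by
        intro a
        cases a with
        | recommend i => exact ih _
        | duel i j =>
          have h0 := winProb_nonneg Δ i j
          have h1 := winProb_le_one Δ i j
          have ht := ih ⟨(i, j, true) :: h, none⟩
          have hf := ih ⟨(i, j, false) :: h, none⟩
          simp only [actionValue]
          rcases h0.eq_or_lt with h0 | h0
          · rw [← h0]; linarith
          · have := mul_pos h0 ht
            have := mul_nonneg (sub_nonneg.2 h1) hf.le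
            linarith
      obtain ⟨a, -, ha⟩ := Finset.exists_ne_zero_of_sum_ne_zero
        (s := Finset.univ) (f := fun a => (A.policy h a).toReal) (by simp [sum_policy])
      exact Finset.sum_pos' (fun a _ => mul_nonneg ENNReal.toReal_nonneg (hv a).le)
        ⟨a, Finset.mem_univ _, mul_pos (lt_of_le_of_ne ENNReal.toReal_nonneg ha.symm) (hv a)⟩
    · simpa using hf _

/-- The states which the run can reach at time `n`: there is one duel per step, until the run
stops. -/
def Reachable (n : ℕ) (x : State K) : Prop :=
  x.history.length ≤ n ∧ (x.output = none → x.history.length = n)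

lemma expect_mono_reachable {f g : State K → ℝ} (n : ℕ)
    (hfg : ∀ y, Reachable n y → f y ≤ g y) :
    expect A Δ n f ⟨[], none⟩ ≤ expect A Δ n g ⟨[], none⟩ := by
  refine expect_mono_on A Δ Reachable ?_ ?_ ?_ (k := 0) n (by simpa using hfg) (by simp [Reachable])
  · rintro k h i ⟨h1, h2⟩
    exact ⟨by simp at h1 ⊢; omega, by simp⟩
  · rintro k h i - ⟨h1, h2⟩
    exact ⟨by simp at h1 ⊢; omega, by simp⟩
  · rintro k h i j b - ⟨h1, h2⟩
    exact ⟨by simp at h1 ⊢; omega, by simp at h2 ⊢; omega⟩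

end Operator

/-! ### The law of the state at a given time -/

section Law

variable {K : ℕ} (A : Algorithm K) (Δ : Matrix (Fin K) (Fin K) ℝ)

lemma lintegral_outcome (i j : Fin K) (f : Bool → ℝ) (hf : ∀ b, 0 ≤ f b) :
    ∑ b, outcome Δ i j b * ENNReal.ofReal (f b) =
      ENNReal.ofReal (winProb Δ i j * f true + (1 - winProb Δ i j) * f false) := by
  have h0 := winProb_nonneg Δ i j
  have h1 := sub_nonneg.2 (winProb_le_one Δ i j)
  rw [Fintype.sum_bool, ENNReal.ofReal_add (mul_nonneg h0 (hf _)) (mul_nonneg h1 (hf _)),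
    ENNReal.ofReal_mul h0, ENNReal.ofReal_mul h1]
  simp [outcome, PMF.ofFintype_apply]

lemma lintegral_toMeasure_bind {α β : Type*} [Fintype α] [MeasurableSpace β] (p : PMF α)
    (q : α → PMF β) (f : β → ℝ≥0∞) :
    ∫⁻ y, f y ∂(p.bind q).toMeasure = ∑ a, p a * ∫⁻ y, f y ∂(q a).toMeasure := by
  have : (p.bind q).toMeasure = ∑ a, p a • (q a).toMeasure := by
    ext s hs
    rw [PMF.toMeasure_bind_apply _ _ _ hs, tsum_fintype]
    simp
  rw [this, lintegral_finsetSum_measure]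
  simp [lintegral_smul_measure]

lemma lintegral_stepKernel (f : State K → ℝ) (hf : ∀ y, 0 ≤ f y) (x : State K) :
    ∫⁻ y, ENNReal.ofReal (f y) ∂(stepKernel A Δ x) = ENNReal.ofReal (step A Δ f x) := by
  change ∫⁻ y, ENNReal.ofReal (f y) ∂(transition A Δ x).toMeasure = _
  rcases x with ⟨h, _ | i⟩
  · have hv : ∀ a, 0 ≤ actionValue Δ f h a := by
      intro a
      cases a with
      | recommend i => exact hf _
      | duel i j =>
        exact add_nonneg (mul_nonneg (winProb_nonneg _ _ _) (hf _))
          (mul_nonneg (sub_nonneg.2 (winProb_le_one _ _ _)) (hf _))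
    rw [step_none, transition, lintegral_toMeasure_bind, ENNReal.ofReal_sum_of_nonneg
      (fun a _ => mul_nonneg ENNReal.toReal_nonneg (hv a))]
    refine Finset.sum_congr rfl fun a _ => ?_
    rw [ENNReal.ofReal_mul ENNReal.toReal_nonneg, ENNReal.ofReal_toReal (PMF.apply_ne_top _ a)]
    congr 1
    cases a with
    | recommend i => simp [PMF.toMeasure_pure, actionValue]
    | duel i j =>
      simp only [PMF.map, lintegral_toMeasure_bind, Function.comp_apply, PMF.toMeasure_pure,
        lintegral_dirac, actionValue]
      exact lintegral_outcome Δ i j (fun b => f ⟨(i, j, b) :: h, none⟩) fun b => hf _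
  · simp [transition, PMF.toMeasure_pure]

lemma step_nonneg {f : State K → ℝ} (hf : ∀ y, 0 ≤ f y) (x : State K) : 0 ≤ step A Δ f x := by
  have := expect_mono A Δ (f := fun _ => 0) hf 1 x
  rwa [expect_const, expect_succ, expect_zero] at this

lemma map_zero_trajMeasure {X : ℕ → Type*} [∀ n, MeasurableSpace (X n)] (μ₀ : Measure (X 0))
    (κ : (n : ℕ) → Kernel (Π i : Finset.Iic n, X i) (X (n + 1))) [∀ n, IsMarkovKernel (κ n)] :
    (Kernel.trajMeasure μ₀ κ).map (fun ω => ω 0) = μ₀ := by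
  have hf : (fun ω : Π n, X n => ω 0) =
      (fun x : Π i : Finset.Iic 0, X i => x ⟨0, Finset.mem_Iic.2 le_rfl⟩) ∘
        Preorder.frestrictLe (π := X) 0 := rfl
  have hm : Measurable fun x : Π i : Finset.Iic 0, X i => x ⟨0, Finset.mem_Iic.2 le_rfl⟩ :=
    measurable_pi_apply _
  rw [hf, ← Measure.map_map hm (Preorder.measurable_frestrictLe 0), Kernel.trajMeasure,
    Measure.map_comp _ _ (Preorder.measurable_frestrictLe 0), Kernel.traj_map_frestrictLe,
    Kernel.partialTraj_self, Measure.id_comp]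
  exact (Measure.map_map hm (MeasurableEquiv.measurable
    (MeasurableEquiv.piUnique fun i : Finset.Iic 0 => X i).symm)).trans Measure.map_id

lemma lintegral_trajMeasure_succ {X : ℕ → Type*} [∀ n, MeasurableSpace (X n)]
    (μ₀ : Measure (X 0)) [IsProbabilityMeasure μ₀]
    (κ : (n : ℕ) → Kernel (Π i : Finset.Iic n, X i) (X (n + 1))) [∀ n, IsMarkovKernel (κ n)]
    (n : ℕ) (f : X (n + 1) → ℝ≥0∞) (hf : Measurable f) :
    ∫⁻ ω, f (ω (n + 1)) ∂(Kernel.trajMeasure μ₀ κ) =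
      ∫⁻ ω, ∫⁻ y, f y ∂(κ n (Preorder.frestrictLe n ω)) ∂(Kernel.trajMeasure μ₀ κ) := by
  have h := congrArg (fun μ => ∫⁻ p, f p.2 ∂μ)
    (Kernel.map_frestrictLe_trajMeasure_compProd_eq_map_trajMeasure (μ₀ := μ₀) (κ := κ) (a := n))
  have hm : Measurable fun p : (Π i : Finset.Iic n, X i) × X (n + 1) => f p.2 :=
    hf.comp measurable_snd
  have hr : Measurable (Preorder.frestrictLe (π := X) n) := Preorder.measurable_frestrictLe n
  simp only [lintegral_map hm (hr.prodMk (measurable_pi_apply (n + 1))),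
    Measure.lintegral_compProd hm] at h
  rw [lintegral_map (Measurable.lintegral_kernel_prod_right' (κ := κ n) hm) hr] at h
  exact h.symm

/-- The expectations computed by `expect` are those of the law of the run. -/
lemma lintegral_law (n : ℕ) (f : State K → ℝ) (hf : ∀ y, 0 ≤ f y) :
    ∫⁻ ω, ENNReal.ofReal (f (ω n)) ∂(law A Δ) = ENNReal.ofReal (expect A Δ n f ⟨[], none⟩) := by
  induction n generalizing f with
  | zero =>
    have hm : Measurable fun y : State K => ENNReal.ofReal (f y) := measurable_from_top
    have h0 : (law A Δ).map (fun ω => ω 0) = Measure.dirac ⟨[], none⟩ :=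
      map_zero_trajMeasure _ _
    rw [← lintegral_map hm (measurable_pi_apply 0), h0, lintegral_dirac]
    rfl
  | succ n ih =>
    have hm : Measurable fun y : State K => ENNReal.ofReal (f y) := measurable_from_top
    rw [expect_succ', ← ih _ (step_nonneg A Δ hf)]
    refine (lintegral_trajMeasure_succ (X := fun _ => State K) _ _ n _ hm).trans (lintegral_congr fun ω => ?_)
    exact lintegral_stepKernel A Δ f hf (ω n)

/-- The law of the state at time `n`, through the operator `expect`. -/
lemma law_apply (n : ℕ) (S : Set (State K)) :
    law A Δ {ω | ω n ∈ S} = ENNReal.ofReal (expect A Δ n (S.indicator 1) ⟨[], none⟩) := by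
  rw [← lintegral_law A Δ n (S.indicator 1)
    (fun y => Set.indicator_nonneg (fun _ _ => zero_le_one) y)]
  have : ∀ ω : ℕ → State K, ENNReal.ofReal (S.indicator 1 (ω n)) =
      {ω : ℕ → State K | ω n ∈ S}.indicator 1 ω := by
    intro ω
    by_cases h : ω n ∈ S <;> simp [Set.indicator, h]
  simp_rw [this]
  rw [lintegral_indicator_one]
  exact measurable_pi_apply n (MeasurableSet.of_discrete (s := S))

end Law

/-! ### Additive functionals of the observations and change of measure -/


/-- The total of `d i j` over the duels `(i, j)` of a history. -/
def weight {K : ℕ} (d : Fin K → Fin K → ℝ) (h : History K) : ℝ :=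
  (h.map fun e => d e.1 e.2.1).sum

section Weight

variable {K : ℕ} (A : Algorithm K) (Δ : Matrix (Fin K) (Fin K) ℝ)

@[simp] lemma weight_nil (d : Fin K → Fin K → ℝ) : weight d [] = 0 := rfl

@[simp] lemma weight_cons (d : Fin K → Fin K → ℝ) (i j : Fin K) (b : Bool) (h : History K) :
    weight d ((i, j, b) :: h) = d i j + weight d h := by simp [weight]

lemma weight_mono {d d' : Fin K → Fin K → ℝ} (hd : ∀ i j, d i j ≤ d' i j) (h : History K) :
    weight d h ≤ weight d' h := by
  induction h with
  | nil => simp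
  | cons e h ih =>
    obtain ⟨i, j, b⟩ := e
    simpa using add_le_add (hd i j) ih

lemma weight_const (c : ℝ) (h : History K) : weight (fun _ _ => c) h = c * h.length := by
  induction h with
  | nil => simp
  | cons e h ih =>
    obtain ⟨i, j, b⟩ := e
    rw [weight_cons, ih, List.length_cons]
    push_cast
    ring

lemma weight_nonneg {d : Fin K → Fin K → ℝ} (hd : ∀ i j, 0 ≤ d i j) (h : History K) :
    0 ≤ weight d h := by
  simpa [weight_const] using weight_mono hd h

/-- The probability that the state at time `n` belongs to `S`. -/
noncomputable def prob (n : ℕ) (S : Set (State K)) : ℝ :=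
  expect A Δ n (S.indicator 1) ⟨[], none⟩

/-- The expected total of `d i j` over the duels `(i, j)` of the first `n` steps, as a linear map
of `d`. -/
noncomputable def mean (n : ℕ) : (Fin K → Fin K → ℝ) →ₗ[ℝ] ℝ where
  toFun d := expect A Δ n (fun x => weight d x.history) ⟨[], none⟩
  map_add' d d' := by
    have : (fun x : State K => weight (d + d') x.history) =
        (fun x => weight d x.history) + fun x => weight d' x.history := by
      ext x
      simp [weight, List.sum_map_add]
    rw [this, map_add, Pi.add_apply]
  map_smul' c d := by
    have : (fun x : State K => weight (c • d) x.history) =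
        c • fun x => weight d x.history := by
      ext x
      simp [weight, List.sum_map_mul_left]
    rw [this, map_smul, Pi.smul_apply, RingHom.id_apply]

lemma mean_apply (n : ℕ) (d : Fin K → Fin K → ℝ) :
    mean A Δ n d = expect A Δ n (fun x => weight d x.history) ⟨[], none⟩ := rfl

lemma mean_mono (n : ℕ) {d d' : Fin K → Fin K → ℝ} (hd : ∀ i j, d i j ≤ d' i j) :
    mean A Δ n d ≤ mean A Δ n d' :=
  expect_mono A Δ (fun y => weight_mono hd y.history) n _

/-- There is at most one duel per step. -/
lemma mean_le (n : ℕ) {d : Fin K → Fin K → ℝ} {c : ℝ} (hc : 0 ≤ c) (hd : ∀ i j, d i j ≤ c) :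
    mean A Δ n d ≤ c * n := by
  have : mean A Δ n d ≤ expect A Δ n (fun _ => c * n) ⟨[], none⟩ := by
    refine expect_mono_reachable A Δ n fun y hy => (weight_mono hd y.history).trans ?_
    rw [weight_const]
    exact mul_le_mul_of_nonneg_left (by exact_mod_cast hy.1) hc
  simpa using this

lemma prob_nonneg (n : ℕ) (S : Set (State K)) : 0 ≤ prob A Δ n S := by
  have := expect_mono A Δ (f := fun _ => 0) (g := S.indicator 1)
    (fun y => Set.indicator_nonneg (fun _ _ => zero_le_one) y) n ⟨[], none⟩
  rwa [expect_const] at this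

lemma law_apply_eq_prob (n : ℕ) (S : Set (State K)) :
    law A Δ {ω | ω n ∈ S} = ENNReal.ofReal (prob A Δ n S) := law_apply A Δ n S

lemma prob_mono (n : ℕ) {S T : Set (State K)} (hST : S ⊆ T) : prob A Δ n S ≤ prob A Δ n T :=
  expect_mono A Δ (fun y => Set.indicator_le_indicator_of_subset hST (fun _ => zero_le_one) y) n _

lemma prob_compl (n : ℕ) (S : Set (State K)) : prob A Δ n Sᶜ = 1 - prob A Δ n S := by
  have h : Sᶜ.indicator (1 : State K → ℝ) = (fun _ => 1) - S.indicator 1 := by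
    rw [Set.indicator_compl]; rfl
  rw [prob, h, map_sub, Pi.sub_apply, expect_const, prob]

/-- The union bound, for a set which is only covered on reachable states. -/
lemma prob_le_add (n : ℕ) {S T U : Set (State K)}
    (h : ∀ x, Reachable n x → x ∈ S → x ∈ T ∨ x ∈ U) :
    prob A Δ n S ≤ prob A Δ n T + prob A Δ n U := by
  rw [prob, prob, prob, ← Pi.add_apply, ← map_add]
  refine expect_mono_reachable A Δ n fun y hy => ?_
  have hT : 0 ≤ T.indicator (1 : State K → ℝ) y := Set.indicator_nonneg (fun _ _ => zero_le_one) y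
  have hU : 0 ≤ U.indicator (1 : State K → ℝ) y := Set.indicator_nonneg (fun _ _ => zero_le_one) y
  by_cases hS : y ∈ S
  · rw [Set.indicator_of_mem hS, Pi.add_apply]
    rcases h y hy hS with hy | hy
    · rw [Set.indicator_of_mem hy]; linarith
    · rw [Set.indicator_of_mem hy]; linarith
  · rw [Set.indicator_of_notMem hS, Pi.add_apply]; linarith

/-- Markov's inequality, summed over a family of functionals. -/
lemma sum_mul_prob_le_mean {ι : Type*} (s : Finset ι) (n : ℕ) (d : ι → Fin K → Fin K → ℝ)
    (y : ι → ℝ) (S : ι → Set (State K)) (hd : ∀ i ∈ s, ∀ a b, 0 ≤ d i a b)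
    (hS : ∀ i ∈ s, ∀ x ∈ S i, y i ≤ weight (d i) x.history) :
    ∑ i ∈ s, y i * prob A Δ n (S i) ≤ mean A Δ n (∑ i ∈ s, d i) := by
  rw [map_sum]
  refine Finset.sum_le_sum fun i hi => ?_
  rw [prob, mean_apply, ← smul_eq_mul, ← Pi.smul_apply, ← map_smul]
  refine expect_mono A Δ (fun x => ?_) n _
  by_cases hx : x ∈ S i
  · simpa [hx] using hS i hi x hx
  · simpa [hx] using weight_nonneg (hd i hi) x.history

end Weight

section ChangeOfMeasure

variable {K : ℕ} (A : Algorithm K)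

lemma winProb_eq {Δ : Matrix (Fin K) (Fin K) ℝ} {i j : Fin K}
    (h : Δ i j ∈ Set.Icc (-(1 / 4) : ℝ) (1 / 4)) : winProb Δ i j = 1 / 2 + Δ i j := by
  rw [winProb, Set.projIcc_of_mem zero_le_one (by constructor <;> linarith [h.1, h.2])]

lemma log_le_log_add_div {v V : ℝ} (hv : 0 < v) (hV : 0 < V) :
    Real.log v ≤ Real.log V + (v / V - 1) := by
  have := Real.log_le_sub_one_of_pos (div_pos hv hV)
  rw [Real.log_div hv.ne' hV.ne'] at this
  linarith

/-- The Donsker–Varadhan inequality for two Bernoulli laws, where the relative entropy is bounded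
by the `χ²` divergence. -/
lemma bernoulli_log_le {p q u v : ℝ} (hp : 1 / 4 ≤ p) (hp' : p ≤ 3 / 4) (hq : 1 / 4 ≤ q)
    (hq' : q ≤ 3 / 4) (hu : 0 < u) (hv : 0 < v) :
    p * Real.log u + (1 - p) * Real.log v ≤
      16 / 3 * (p - q) ^ 2 + Real.log (q * u + (1 - q) * v) := by
  have hp0 : 0 < p := by linarith
  have hp1 : 0 < 1 - p := by linarith
  have hq0 : 0 < q := by linarith
  have hq1 : 0 < 1 - q := by linarith
  set Z := q * u + (1 - q) * v with hZ
  have hZ0 : 0 < Z := by positivity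
  -- `log u` is split as `log Z + log (p / q) + log (u q / (Z p))`.
  have h1 := log_le_log_add_div hu (V := Z * p / q) (by positivity)
  have h2 := log_le_log_add_div hv (V := Z * (1 - p) / (1 - q)) (by positivity)
  have h3 := Real.log_le_sub_one_of_pos (div_pos hp0 hq0)
  have h4 := Real.log_le_sub_one_of_pos (div_pos hp1 hq1)
  rw [mul_div_assoc, Real.log_mul hZ0.ne' (by positivity)] at h1 h2
  have h5 : p * (u / (Z * (p / q))) + (1 - p) * (v / (Z * ((1 - p) / (1 - q)))) = 1 := by
    field_simp
    linarith
  have h6 : p * (p / q) + (1 - p) * ((1 - p) / (1 - q)) - 1 ≤ 16 / 3 * (p - q) ^ 2 := by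
    have : p * (p / q) + (1 - p) * ((1 - p) / (1 - q)) - 1 = (p - q) ^ 2 / (q * (1 - q)) := by
      field_simp
      ring
    rw [this, div_le_iff₀ (by positivity)]
    have : 3 / 16 ≤ q * (1 - q) := by nlinarith
    nlinarith [sq_nonneg (p - q)]
  have h7 := mul_le_mul_of_nonneg_left h1 hp0.le
  have h8 := mul_le_mul_of_nonneg_left h2 hp1.le
  have h9 := mul_le_mul_of_nonneg_left h3 hp0.le
  have h10 := mul_le_mul_of_nonneg_left h4 hp1.le
  nlinarith

/-- An upper bound for the relative entropy between the outcomes of a duel in two environments. -/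
noncomputable def duelCost (Δ₁ Δ₂ : Matrix (Fin K) (Fin K) ℝ) (i j : Fin K) : ℝ :=
  16 / 3 * (Δ₁ i j - Δ₂ i j) ^ 2

lemma duelCost_comm (Δ₁ Δ₂ : Matrix (Fin K) (Fin K) ℝ) : duelCost Δ₁ Δ₂ = duelCost Δ₂ Δ₁ := by
  ext i j
  simp only [duelCost]
  ring

variable {Δ₁ Δ₂ : Matrix (Fin K) (Fin K) ℝ}

/-- The Donsker–Varadhan inequality for the laws of a run in two environments, with the chain rule
for the relative entropy built in. -/
lemma expect_log_le (h₁ : ∀ i j, Δ₁ i j ∈ Set.Icc (-(1 / 4) : ℝ) (1 / 4))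
    (h₂ : ∀ i j, Δ₂ i j ∈ Set.Icc (-(1 / 4) : ℝ) (1 / 4)) {Z : State K → ℝ} (hZ : ∀ x, 0 < Z x)
    (n : ℕ) (x : State K) :
    expect A Δ₁ n (fun y => Real.log (Z y)) x ≤
      expect A Δ₁ n (fun y => weight (duelCost Δ₁ Δ₂) y.history) x -
        weight (duelCost Δ₁ Δ₂) x.history + Real.log (expect A Δ₂ n Z x) := by
  induction n generalizing x with
  | zero => simp
  | succ n ih =>
    rcases x with ⟨h, _ | i⟩
    · rw [expect_succ_none, expect_succ_none, expect_succ_none]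
      set F := expect A Δ₁ n (fun y => Real.log (Z y))
      set G := expect A Δ₁ n (fun y => weight (duelCost Δ₁ Δ₂) y.history)
      set w := weight (duelCost Δ₁ Δ₂) h with hw
      have hE := expect_pos A Δ₂ hZ n
      have hEs := expect_pos A Δ₂ hZ (n + 1) ⟨h, none⟩
      rw [expect_succ_none] at hEs
      set E := expect A Δ₂ n Z
      set V := ∑ a, (A.policy h a).toReal * actionValue Δ₂ E h a with hV
      have key : ∀ a, actionValue Δ₁ F h a ≤ actionValue Δ₁ G h a - w + Real.log V +
          (actionValue Δ₂ E h a / V - 1) := by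
        intro a
        cases a with
        | recommend i =>
          have := ih ⟨h, some i⟩
          have := log_le_log_add_div (hE ⟨h, some i⟩) hEs
          simp only [actionValue]
          linarith
        | duel i j =>
          have ht := ih ⟨(i, j, true) :: h, none⟩
          have hf := ih ⟨(i, j, false) :: h, none⟩
          simp only [weight_cons, ← hw] at ht hf
          simp only [actionValue]
          rw [winProb_eq (h₁ i j), winProb_eq (h₂ i j)]
          obtain ⟨a1, a2⟩ := h₁ i j
          obtain ⟨b1, b2⟩ := h₂ i j
          have hb := bernoulli_log_le (p := 1 / 2 + Δ₁ i j) (q := 1 / 2 + Δ₂ i j)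
            (by linarith) (by linarith) (by linarith) (by linarith)
            (hE ⟨(i, j, true) :: h, none⟩) (hE ⟨(i, j, false) :: h, none⟩)
          have hpos : 0 < (1 / 2 + Δ₂ i j) * E ⟨(i, j, true) :: h, none⟩ +
              (1 - (1 / 2 + Δ₂ i j)) * E ⟨(i, j, false) :: h, none⟩ :=
            add_pos (mul_pos (by linarith) (hE _)) (mul_pos (by linarith) (hE _))
          have hl := log_le_log_add_div hpos hEs
          have h1 := mul_le_mul_of_nonneg_left ht (show 0 ≤ 1 / 2 + Δ₁ i j by linarith)
          have h2 := mul_le_mul_of_nonneg_left hf (show 0 ≤ 1 - (1 / 2 + Δ₁ i j) by linarith)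
          have hc : duelCost Δ₁ Δ₂ i j = 16 / 3 * (1 / 2 + Δ₁ i j - (1 / 2 + Δ₂ i j)) ^ 2 := by
            simp only [duelCost]
            ring
          rw [← hc] at hb
          linarith
      calc ∑ a, (A.policy h a).toReal * actionValue Δ₁ F h a
          ≤ ∑ a, (A.policy h a).toReal * (actionValue Δ₁ G h a - w + Real.log V +
            (actionValue Δ₂ E h a / V - 1)) :=
            Finset.sum_le_sum fun a _ => mul_le_mul_of_nonneg_left (key a) ENNReal.toReal_nonneg
        _ = ∑ a, ((A.policy h a).toReal * actionValue Δ₁ G h a +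
              (A.policy h a).toReal * (Real.log V - w - 1) +
              (A.policy h a).toReal * actionValue Δ₂ E h a / V) :=
            Finset.sum_congr rfl fun a _ => by ring
        _ = ∑ a, (A.policy h a).toReal * actionValue Δ₁ G h a - w + Real.log V := by
            rw [Finset.sum_add_distrib, Finset.sum_add_distrib, ← Finset.sum_mul, sum_policy,
              ← Finset.sum_div, ← hV, div_self hEs.ne']
            ring
    · simp

/-- If an event has a large probability in the environment `Δ₁` and a small one in `Δ₂`, then the
duels which tell `Δ₁` from `Δ₂` are queried often in `Δ₁`. This is the Donsker–Varadhan inequality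
for the function which is `log r` on the event and zero elsewhere. -/
lemma prob_mul_log_le (h₁ : ∀ i j, Δ₁ i j ∈ Set.Icc (-(1 / 4) : ℝ) (1 / 4))
    (h₂ : ∀ i j, Δ₂ i j ∈ Set.Icc (-(1 / 4) : ℝ) (1 / 4)) (n : ℕ) (S : Set (State K)) {r : ℝ}
    (hr : 1 ≤ r) :
    prob A Δ₁ n S * Real.log r ≤ mean A Δ₁ n (duelCost Δ₁ Δ₂) + (r - 1) * prob A Δ₂ n S := by
  have hZ : ∀ x, 0 < ((fun _ => 1) + (r - 1) • S.indicator 1 : State K → ℝ) x := by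
    intro x
    by_cases hx : x ∈ S <;> simp [hx]
    linarith
  have h := expect_log_le A h₁ h₂ hZ n ⟨[], none⟩
  have hlog : (fun y => Real.log (((fun _ => 1) + (r - 1) • S.indicator 1 : State K → ℝ) y)) =
      Real.log r • S.indicator 1 := by
    ext x
    by_cases hx : x ∈ S <;> simp [hx]
  rw [hlog, map_smul, map_add, map_smul, Pi.smul_apply, Pi.add_apply, Pi.smul_apply, expect_const,
    smul_eq_mul, smul_eq_mul, ← mean_apply, weight_nil] at h
  change Real.log r * prob A Δ₁ n S ≤ _ - 0 + Real.log (1 + (r - 1) * prob A Δ₂ n S) at h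
  have := Real.log_le_sub_one_of_pos (x := 1 + (r - 1) * prob A Δ₂ n S)
    (add_pos_of_pos_of_nonneg one_pos (mul_nonneg (by linarith) (prob_nonneg A Δ₂ n S)))
  linarith

end ChangeOfMeasure

/-! ### Stopping an algorithm early -/

section Truncation

variable {K : ℕ} (A : Algorithm K) (i₀ : Fin K) (d : Fin K → Fin K → ℝ) (y : ℝ)

open Classical in
/-- The algorithm which follows `A` until the functional `weight d` exceeds `y - 1`, and then stops
and recommends the arm `i₀`. When `d ≤ 1`, the functional never exceeds `y`. -/
noncomputable def truncate : Algorithm K where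
  policy h := if y - 1 < weight d h then PMF.pure (.recommend i₀) else A.policy h

variable {d y}

lemma mean_truncate_le (hd : ∀ i j, d i j ≤ 1) (hy : 0 ≤ y) (Δ : Matrix (Fin K) (Fin K) ℝ)
    (n : ℕ) : mean (truncate A i₀ d y) Δ n d ≤ y := by
  have : mean (truncate A i₀ d y) Δ n d ≤
      expect (truncate A i₀ d y) Δ n (fun _ => y) ⟨[], none⟩ := by
    refine expect_mono_on _ Δ (fun _ x => weight d x.history ≤ y) (fun _ _ _ h => h)
      (fun _ _ _ _ h => h) ?_ (k := 0) n (fun _ h => h) (by simpa using hy)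
    intro k h i j b ha _
    have hw : ¬ y - 1 < weight d h := by
      intro hw
      simp [truncate, hw] at ha
    have := hd i j
    simp only [weight_cons]
    linarith
  simpa using this

/-- Truncation does not affect the events which contain all the states at which it is active. -/
lemma prob_truncate (hd : ∀ i j, 0 ≤ d i j) (Δ : Matrix (Fin K) (Fin K) ℝ) (n : ℕ)
    {S : Set (State K)} (hS : ∀ x : State K, y - 1 < weight d x.history → x ∈ S) :
    prob (truncate A i₀ d y) Δ n S = prob A Δ n S := by
  have hone : ∀ (A' : Algorithm K) n (x : State K), y - 1 < weight d x.history →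
      expect A' Δ n (S.indicator 1) x = 1 := by
    intro A' n x hx
    have hle := expect_mono A' Δ (f := S.indicator 1) (g := fun _ => 1)
      (fun z => Set.indicator_le_self' (fun _ _ => zero_le_one) z) n x
    have hge := expect_mono_on A' Δ (fun _ z => y - 1 < weight d z.history) (fun _ _ _ h => h)
      (fun _ _ _ _ h => h) (fun k h i j b _ hw => by
        have := hd i j
        simp only [weight_cons] at hw ⊢
        linarith) (k := 0) (f := fun _ => 1) (g := S.indicator 1) n
      (fun z hz => by rw [Set.indicator_of_mem (hS z hz)]; rfl) hx
    rw [expect_const] at hle hge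
    exact le_antisymm hle hge
  suffices h : ∀ x, expect (truncate A i₀ d y) Δ n (S.indicator 1) x =
      expect A Δ n (S.indicator 1) x from h _
  induction n with
  | zero => exact fun _ => rfl
  | succ n ih =>
    intro x
    by_cases hx : y - 1 < weight d x.history
    · rw [hone _ _ _ hx, hone _ _ _ hx]
    rcases x with ⟨h, _ | i⟩
    · rw [expect_succ_none, expect_succ_none, funext ih]
      simp only at hx
      simp only [truncate, if_neg hx]
    · simp

end Truncation

/-! ### The order statistics of a row -/


section OrderedGap

variable {K : ℕ} {Δ : Matrix (Fin K) (Fin K) ℝ} {i : Fin K} {s : ℕ}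

lemma orderedGap_le (hΔ : ∀ j, -(1 / 4) ≤ Δ i j) (hs : 1 ≤ s) {x : ℝ}
    (hx : s ≤ Set.ncard {j | Δ i j ≤ x}) : orderedGap Δ i s ≤ x := by
  refine csInf_le ⟨-(1 / 4), fun z hz => ?_⟩ hx
  obtain ⟨j, hj⟩ := Set.nonempty_of_ncard_ne_zero
    (s := {j | Δ i j ≤ z}) (by have : s ≤ _ := hz; omega)
  exact (hΔ j).trans hj

/-- The negative entries of a row are bounded away from zero. -/
lemma exists_neg_le_ncard (hs : 1 ≤ s) (hsn : s ≤ numNeg Δ i) :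
    ∃ x < 0, s ≤ Set.ncard {j | Δ i j ≤ x} := by
  have hne : (Set.toFinite {j | Δ i j < 0}).toFinset.Nonempty := by
    rw [Set.Finite.toFinset_nonempty]
    exact Set.nonempty_of_ncard_ne_zero (by have : s ≤ Set.ncard _ := hsn; omega)
  obtain ⟨j, hj, hmax⟩ := Finset.exists_max_image _ (Δ i) hne
  refine ⟨Δ i j, by simpa using hj, hsn.trans ?_⟩
  exact Set.ncard_le_ncard (fun k hk => hmax k (by simpa using hk)) (Set.toFinite _)

lemma orderedGap_neg (hΔ : ∀ j, -(1 / 4) ≤ Δ i j) (hs : 1 ≤ s) (hsn : s ≤ numNeg Δ i) :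
    orderedGap Δ i s < 0 := by
  obtain ⟨x, hx, h⟩ := exists_neg_le_ncard hs hsn
  exact (orderedGap_le hΔ hs h).trans_lt hx

lemma le_orderedGap (hs : 1 ≤ s) (hsn : s ≤ numNeg Δ i) {c : ℝ}
    (hc : ∀ x < c, Set.ncard {j | Δ i j ≤ x} < s) : c ≤ orderedGap Δ i s := by
  obtain ⟨x, -, h⟩ := exists_neg_le_ncard hs hsn
  exact le_csInf ⟨x, h⟩ fun z hz => not_lt.1 fun hzc => (hc z hzc).not_ge hz

end OrderedGap

/-! ### A cyclic tournament -/

/-- An orientation of some of the pairs of arms different from `i₀`: the arm `i` points to the `m`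
distinct arms `out i a`, and no two arms point to each other. -/
structure Tournament {K : ℕ} (m : ℕ) (i₀ : Fin K) where
  out : Fin K → ZMod m → Fin K
  injective : ∀ i, i ≠ i₀ → Function.Injective (out i)
  out_ne : ∀ i, i ≠ i₀ → ∀ a, out i a ≠ i₀
  asymm : ∀ i j, i ≠ i₀ → j ≠ i₀ → ∀ a b, out i a = j → out j b ≠ i

/-- The arms different from `i₀` are arranged on a cycle of length `K - 1`, and each of them points
to its `m` successors. -/
lemma exists_tournament {K m : ℕ} [NeZero m] (hm : 2 * m + 2 ≤ K) (i₀ : Fin K) :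
    Nonempty (Tournament m i₀) := by
  have hm0 := Nat.pos_of_neZero m
  have : NeZero (K - 1) := ⟨by omega⟩
  have hcard : Fintype.card {i : Fin K // i ≠ i₀} = Fintype.card (ZMod (K - 1)) := by
    rw [ZMod.card, Fintype.card_subtype_compl, Fintype.card_fin, Fintype.card_subtype_eq]
  let e : {i : Fin K // i ≠ i₀} ≃ ZMod (K - 1) := Fintype.equivOfCardEq hcard
  let f : Fin K → ZMod m → Fin K := fun i a =>
    if h : i ≠ i₀ then (e.symm (e ⟨i, h⟩ + ((a.val + 1 : ℕ) : ZMod (K - 1)))).1 else i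
  have hf : ∀ i (h : i ≠ i₀) a,
      f i a = (e.symm (e ⟨i, h⟩ + ((a.val + 1 : ℕ) : ZMod (K - 1)))).1 := fun i h a => dif_pos h
  refine ⟨⟨f, fun i hi a b hab => ?_, fun i hi a => ?_, fun i j hi hj a b hij hji => ?_⟩⟩
  · rw [hf i hi, hf i hi] at hab
    have h := add_left_cancel (e.symm.injective (Subtype.ext hab))
    rw [ZMod.natCast_eq_natCast_iff'] at h
    have ha := ZMod.val_lt a
    have hb := ZMod.val_lt b
    rw [Nat.mod_eq_of_lt (by omega), Nat.mod_eq_of_lt (by omega)] at h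
    exact ZMod.val_injective m (by omega)
  · rw [hf i hi]
    exact (e.symm _).2
  · have h1 : e ⟨j, hj⟩ = e ⟨i, hi⟩ + ((a.val + 1 : ℕ) : ZMod (K - 1)) := by
      rw [← Equiv.eq_symm_apply]
      exact Subtype.ext (by rw [← hf i hi, hij])
    have h2 : e ⟨i, hi⟩ = e ⟨j, hj⟩ + ((b.val + 1 : ℕ) : ZMod (K - 1)) := by
      rw [← Equiv.eq_symm_apply]
      exact Subtype.ext (by rw [← hf j hj, hji])
    rw [h1, add_assoc, left_eq_add, ← Nat.cast_add, ZMod.natCast_eq_zero_iff] at h2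
    have ha := ZMod.val_lt a
    have hb := ZMod.val_lt b
    exact absurd (Nat.le_of_dvd (by omega) h2) (by omega)

/-! ### The hard environments -/

section Env

variable {K m : ℕ} {i₀ : Fin K} (T : Tournament m i₀) (s : Fin K → ℕ) (g : Fin K → ℝ)
  (ε : ℝ) (σ : Fin K → ZMod m)

/-- The arm `i ≠ i₀` loses against `s i` of the `m` arms which it points to: those whose labels
form the cyclic interval of length `s i` which starts at `σ i`. -/
def Loses (i j : Fin K) : Prop := i ≠ i₀ ∧ ∃ a, T.out i a = j ∧ (a - σ i).val < s i

open Classical in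
/-- The environment in which `i` loses with the gap `-g i` against the arms selected by `σ i`, the
arm `i₀` beats all the others by a tiny margin `ε`, and all the other gaps are zero. -/
noncomputable def env : Matrix (Fin K) (Fin K) ℝ := fun i j =>
  if Loses T s σ i j then -g i else if Loses T s σ j i then g j else
    if i = i₀ ∧ j ≠ i₀ then ε else if j = i₀ ∧ i ≠ i₀ then -ε else 0

open Classical in
/-- The modification of `env` in which the arm `i₁` becomes the Condorcet winner: the entries of its
row which are not positive become `ε`. -/
noncomputable def altEnv (i₁ : Fin K) : Matrix (Fin K) (Fin K) ℝ := fun i j =>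
  if i = j then 0 else if i = i₁ then (if Loses T s σ j i then g j else ε) else
    if j = i₁ then (if Loses T s σ i j then -g i else -ε) else env T s g ε σ i j

open Classical in
/-- The indicator of the duels between `i` and the arms against which it loses. -/
noncomputable def lossInd (i a b : Fin K) : ℝ :=
  if (a = i ∧ Loses T s σ i b) ∨ (b = i ∧ Loses T s σ i a) then 1 else 0

open Classical in
/-- The indicator of the duels between `i` and the arms which it points to. -/
noncomputable def outInd (i a b : Fin K) : ℝ :=
  if (a = i ∧ ∃ c, T.out i c = b) ∨ (b = i ∧ ∃ c, T.out i c = a) then 1 else 0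

variable {T s g ε σ}

lemma Loses.ne_left {i j : Fin K} (h : Loses T s σ i j) : i ≠ i₀ := h.1

lemma Loses.ne_right {i j : Fin K} (h : Loses T s σ i j) : j ≠ i₀ := by
  obtain ⟨hi, a, rfl, -⟩ := h
  exact T.out_ne i hi a

lemma Loses.asymm {i j : Fin K} (h : Loses T s σ i j) : ¬ Loses T s σ j i := by
  rintro ⟨hj, b, hb, -⟩
  obtain ⟨hi, a, ha, -⟩ := h
  exact T.asymm i j hi hj a b ha hb

lemma not_loses_self (i : Fin K) : ¬ Loses T s σ i i := fun h => h.asymm h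

lemma card_val_sub_lt [NeZero m] (c : ZMod m) {r : ℕ} (hr : r ≤ m) :
    (Finset.univ.filter fun a : ZMod m => (a - c).val < r).card = r := by
  rw [← Finset.card_range r]
  refine Finset.card_bij (fun a _ => (a - c).val) (fun a ha => by simpa using ha)
    (fun a _ b _ hab => sub_left_injective (ZMod.val_injective m hab)) fun k hk => ?_
  have hk' : k < m := (Finset.mem_range.1 hk).trans_le hr
  exact ⟨(k : ZMod m) + c, by simpa [ZMod.val_natCast_of_lt hk'] using hk,
    by simp [ZMod.val_natCast_of_lt hk']⟩

lemma card_val_const_sub_lt [NeZero m] (c : ZMod m) {r : ℕ} (hr : r ≤ m) :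
    (Finset.univ.filter fun k : ZMod m => (c - k).val < r).card = r := by
  refine (Finset.card_equiv (Equiv.subLeft c) fun k => ?_).trans (card_val_sub_lt (0 : ZMod m) hr)
  simp

lemma ncard_loses [NeZero m] {i : Fin K} (hi : i ≠ i₀) (hs : s i ≤ m) :
    Set.ncard {j | Loses T s σ i j} = s i := by
  have : {j | Loses T s σ i j} =
      T.out i '' ↑(Finset.univ.filter fun a : ZMod m => (a - σ i).val < s i) := by
    ext j
    simp only [Loses, Set.mem_ofPred_eq, Set.mem_image, Finset.coe_filter, Finset.mem_univ, true_and]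
    exact ⟨fun ⟨_, a, h1, h2⟩ => ⟨a, h2, h1⟩, fun ⟨a, h2, h1⟩ => ⟨hi, a, h1, h2⟩⟩
  rw [this, Set.ncard_image_of_injective _ (T.injective i hi), Set.ncard_coe_finset,
    card_val_sub_lt _ hs]

/-- The admissible gaps `g i` and margins `ε` of the hard environments; that `ε` is below all the
gaps keeps the opponents which `σ` selects at the bottom of each row. -/
structure GapBounds (i₀ : Fin K) (g : Fin K → ℝ) (ε : ℝ) : Prop where
  pos : ∀ i, i ≠ i₀ → 0 < g i
  le : ∀ i, i ≠ i₀ → g i ≤ 1 / 4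
  eps_pos : 0 < ε
  eps_le : ε ≤ 1 / 4
  eps_le_gap : ∀ i, i ≠ i₀ → ε ≤ g i

lemma env_of_loses {i j : Fin K} (h : Loses T s σ i j) : env T s g ε σ i j = -g i := if_pos h

lemma env_of_loses' {i j : Fin K} (h : Loses T s σ j i) : env T s g ε σ i j = g j := by
  rw [env, if_neg h.asymm, if_pos h]

lemma env_left {j : Fin K} (hj : j ≠ i₀) : env T s g ε σ i₀ j = ε := by
  rw [env, if_neg fun h => h.ne_left rfl, if_neg fun h => h.ne_right rfl, if_pos ⟨rfl, hj⟩]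

lemma env_right {i : Fin K} (hi : i ≠ i₀) : env T s g ε σ i i₀ = -ε := by
  rw [env, if_neg fun h => h.ne_right rfl, if_neg fun h => h.ne_left rfl,
    if_neg fun h => hi h.1, if_pos ⟨rfl, hi⟩]

lemma env_eq_zero {i j : Fin K} (h : ¬ Loses T s σ i j) (h' : ¬ Loses T s σ j i)
    (hi : i ≠ i₀ ∨ j = i₀) (hj : j ≠ i₀ ∨ i = i₀) : env T s g ε σ i j = 0 := by
  rw [env, if_neg h, if_neg h', if_neg (by tauto), if_neg (by tauto)]

lemma env_skew (i j : Fin K) : env T s g ε σ i j = -env T s g ε σ j i := by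
  by_cases h : Loses T s σ i j
  · rw [env_of_loses h, env_of_loses' h]
  by_cases h' : Loses T s σ j i
  · rw [env_of_loses h', env_of_loses' h', neg_neg]
  by_cases hi : i = i₀ <;> by_cases hj : j = i₀
  · rw [env_eq_zero h h' (Or.inr hj) (Or.inr hi), env_eq_zero h' h (Or.inr hi) (Or.inr hj), neg_zero]
  · subst hi; rw [env_left hj, env_right hj, neg_neg]
  · subst hj; rw [env_left hi, env_right hi]
  · rw [env_eq_zero h h' (Or.inl hi) (Or.inl hj), env_eq_zero h' h (Or.inl hj) (Or.inl hi), neg_zero]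

lemma env_mem_Icc (hg : GapBounds i₀ g ε) (i j : Fin K) :
    env T s g ε σ i j ∈ Set.Icc (-(1 / 4) : ℝ) (1 / 4) := by
  have he := hg.eps_pos
  have he' := hg.eps_le
  rw [env]
  split_ifs with h1 h2
  · have := hg.pos i h1.ne_left
    have := hg.le i h1.ne_left
    constructor <;> linarith
  · have := hg.pos j h2.ne_left
    have := hg.le j h2.ne_left
    constructor <;> linarith
  all_goals constructor <;> linarith

lemma env_isCW (hg : GapBounds i₀ g ε) : IsCW (env T s g ε σ) i₀ := fun j hj => by
  rw [env_left hj]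
  exact hg.eps_pos

lemma env_mem_Dcw (hg : GapBounds i₀ g ε) : env T s g ε σ ∈ Dcw K :=
  ⟨env_mem_Icc hg, by ext i j; exact env_skew i j, i₀, env_isCW hg⟩

lemma altEnv_skew (i₁ i j : Fin K) : altEnv T s g ε σ i₁ i j = -altEnv T s g ε σ i₁ j i := by
  unfold altEnv
  by_cases hij : i = j
  · simp [hij]
  have hji : ¬ j = i := fun h => hij h.symm
  by_cases hi : i = i₁
  · have hj : ¬ j = i₁ := fun h => hij (hi.trans h.symm)
    simp only [if_neg hij, if_neg hji, if_pos hi, if_neg hj]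
    split_ifs <;> simp
  by_cases hj : j = i₁
  · simp only [if_neg hij, if_neg hji, if_neg hi, if_pos hj]
    split_ifs <;> simp
  simp only [if_neg hij, if_neg hji, if_neg hi, if_neg hj]
  exact env_skew i j

lemma altEnv_mem_Icc (hg : GapBounds i₀ g ε) (i₁ i j : Fin K) :
    altEnv T s g ε σ i₁ i j ∈ Set.Icc (-(1 / 4) : ℝ) (1 / 4) := by
  have he := hg.eps_pos
  have he' := hg.eps_le
  rw [altEnv]
  split_ifs with h1 h2 h3 h4 h5
  · constructor <;> linarith
  · have := hg.pos j h3.ne_left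
    have := hg.le j h3.ne_left
    constructor <;> linarith
  · constructor <;> linarith
  · have := hg.pos i h5.ne_left
    have := hg.le i h5.ne_left
    constructor <;> linarith
  · constructor <;> linarith
  · exact env_mem_Icc hg i j

lemma altEnv_isCW (hg : GapBounds i₀ g ε) (i₁ : Fin K) : IsCW (altEnv T s g ε σ i₁) i₁ := by
  intro j hj
  rw [altEnv, if_neg hj.symm, if_pos rfl]
  split_ifs with h
  · exact hg.pos j h.ne_left
  · exact hg.eps_pos

lemma altEnv_mem_Dcw (hg : GapBounds i₀ g ε) (i₁ : Fin K) : altEnv T s g ε σ i₁ ∈ Dcw K :=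
  ⟨altEnv_mem_Icc hg i₁, by ext i j; exact altEnv_skew i₁ i j, i₁, altEnv_isCW hg i₁⟩

lemma loses_congr {σ' : Fin K → ZMod m} {i : Fin K} (h : σ i = σ' i) (j : Fin K) :
    Loses T s σ i j ↔ Loses T s σ' i j := by
  simp only [Loses, h]

/-- The environment in which `i₁` is the Condorcet winner does not depend on the arms against
which `i₁` loses in `env`. -/
lemma altEnv_congr {σ' : Fin K → ZMod m} {i₁ : Fin K} (h : ∀ i, i ≠ i₁ → σ i = σ' i) :
    altEnv T s g ε σ i₁ = altEnv T s g ε σ' i₁ := by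
  classical
  ext i j
  unfold altEnv
  by_cases hij : i = j
  · simp only [if_pos hij]
  by_cases hi : i = i₁
  · have hj : j ≠ i₁ := fun h => hij (hi.trans h.symm)
    simp only [if_neg hij, if_pos hi]
    exact if_congr (loses_congr (h j hj) i) rfl rfl
  by_cases hj : j = i₁
  · simp only [if_neg hij, if_neg hi, if_pos hj]
    exact if_congr (loses_congr (h i hi) j) rfl rfl
  simp only [if_neg hij, if_neg hi, if_neg hj, env]
  exact if_congr (loses_congr (h i hi) j) rfl (if_congr (loses_congr (h j hj) i) rfl rfl)

lemma duelCost_env_left (hg : GapBounds i₀ g ε) {i₁ : Fin K} (hi₁ : i₁ ≠ i₀) (b : Fin K) :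
    duelCost (env T s g ε σ) (altEnv T s g ε σ i₁) i₁ b ≤
      32 / 3 * g i₁ ^ 2 * lossInd T s σ i₁ i₁ b + 64 / 3 * ε ^ 2 := by
  have he := hg.eps_pos
  have hind : 0 ≤ 32 / 3 * g i₁ ^ 2 * lossInd T s σ i₁ i₁ b := by
    have : 0 ≤ lossInd T s σ i₁ i₁ b := by rw [lossInd]; split_ifs <;> norm_num
    positivity
  have key : |env T s g ε σ i₁ b - altEnv T s g ε σ i₁ i₁ b| ≤ 2 * ε →
      duelCost (env T s g ε σ) (altEnv T s g ε σ i₁) i₁ b ≤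
      32 / 3 * g i₁ ^ 2 * lossInd T s σ i₁ i₁ b + 64 / 3 * ε ^ 2 := by
    intro h
    have := sq_le_sq' (abs_le.1 h).1 (abs_le.1 h).2
    simp only [duelCost]
    nlinarith
  by_cases hb : b = i₁
  · subst hb
    refine key ?_
    rw [env_eq_zero (not_loses_self _) (not_loses_self _) (Or.inl hi₁) (Or.inl hi₁), altEnv,
      if_pos rfl, sub_zero, abs_zero]
    positivity
  have halt : ∀ h : ¬ Loses T s σ b i₁, altEnv T s g ε σ i₁ i₁ b = ε := fun h => by
    rw [altEnv, if_neg (Ne.symm hb), if_pos rfl, if_neg h]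
  by_cases h1 : Loses T s σ i₁ b
  · rw [duelCost, env_of_loses h1, halt h1.asymm, lossInd, if_pos (Or.inl ⟨rfl, h1⟩)]
    nlinarith [sq_nonneg (g i₁ - ε), sq_nonneg ε]
  by_cases h2 : Loses T s σ b i₁
  · refine key ?_
    rw [env_of_loses' h2, altEnv, if_neg (Ne.symm hb), if_pos rfl, if_pos h2, sub_self, abs_zero]
    positivity
  refine key ?_
  rw [halt h2]
  by_cases hb0 : b = i₀
  · subst hb0
    rw [env_right hi₁, abs_le]
    constructor <;> linarith
  · rw [env_eq_zero h1 h2 (Or.inl hi₁) (Or.inl hb0), abs_le]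
    constructor <;> linarith

lemma lossInd_symm (i a b : Fin K) : lossInd T s σ i a b = lossInd T s σ i b a := by
  classical exact if_congr or_comm rfl rfl

/-- The duels which tell `env` from `altEnv` at a substantial rate are those between `i₁` and the
arms against which it loses. -/
lemma duelCost_env_le (hg : GapBounds i₀ g ε) {i₁ : Fin K} (hi₁ : i₁ ≠ i₀) (a b : Fin K) :
    duelCost (env T s g ε σ) (altEnv T s g ε σ i₁) a b ≤
      32 / 3 * g i₁ ^ 2 * lossInd T s σ i₁ a b + 64 / 3 * ε ^ 2 := by
  by_cases ha : a = i₁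
  · subst ha
    exact duelCost_env_left hg hi₁ b
  by_cases hb : b = i₁
  · subst hb
    have h := duelCost_env_left (T := T) (s := s) (σ := σ) hg hi₁ a
    rw [lossInd_symm] at h
    refine le_of_eq_of_le ?_ h
    rw [duelCost, duelCost, env_skew a b, altEnv_skew b a b]
    ring
  · have hz : duelCost (env T s g ε σ) (altEnv T s g ε σ i₁) a b = 0 := by
      have : altEnv T s g ε σ i₁ a b = env T s g ε σ a b := by
        rw [altEnv]
        split_ifs with hab
        · subst hab
          refine (env_eq_zero (not_loses_self _) (not_loses_self _) ?_ ?_).symm <;> tauto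
        · rfl
      rw [duelCost, this]
      ring
    have : 0 ≤ lossInd T s σ i₁ a b := by rw [lossInd]; split_ifs <;> norm_num
    rw [hz]
    positivity

lemma outInd_nonneg (i a b : Fin K) : 0 ≤ outInd T i a b := by
  rw [outInd]; split_ifs <;> norm_num

lemma outInd_le_one (i a b : Fin K) : outInd T i a b ≤ 1 := by
  rw [outInd]; split_ifs <;> norm_num

lemma lossInd_le_outInd (i a b : Fin K) : lossInd T s σ i a b ≤ outInd T i a b := by
  rw [lossInd, outInd]
  split_ifs with h1 h2
  · exact le_rfl
  · refine absurd ?_ h2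
    rcases h1 with ⟨h, _, c, hc, -⟩ | ⟨h, _, c, hc, -⟩
    · exact Or.inl ⟨h, c, hc⟩
    · exact Or.inr ⟨h, c, hc⟩
  · norm_num
  · exact le_rfl

/-- A duel is attributed to at most one arm. -/
lemma sum_outInd_le (a b : Fin K) : ∑ i : {i // i ≠ i₀}, outInd T i.1 a b ≤ 1 := by
  by_cases h : ∃ i : {i // i ≠ i₀}, outInd T i.1 a b ≠ 0
  · obtain ⟨⟨i, hi⟩, h⟩ := h
    rw [Finset.sum_eq_single ⟨i, hi⟩]
    · exact outInd_le_one _ _ _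
    · rintro ⟨j, hj⟩ - hji
      by_contra hne
      have hji' : j ≠ i := fun h => hji (Subtype.ext h)
      simp only [outInd, ne_eq, ite_eq_right_iff, one_ne_zero, imp_false, not_not] at h hne
      rcases h with ⟨rfl, c, hc⟩ | ⟨rfl, c, hc⟩ <;> rcases hne with ⟨rfl, c', hc'⟩ | ⟨rfl, c', hc'⟩
      · exact hji' rfl
      · exact T.asymm _ _ hi hj c c' hc hc'
      · exact T.asymm _ _ hi hj c c' hc hc'
      · exact hji' rfl
    · simp
  · push Not at h
    rw [Finset.sum_eq_zero fun i _ => h i]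
    exact zero_le_one

/-- Over the cyclic shifts of the set of arms against which `i` loses, each of the arms which `i`
points to is selected `s i` times. -/
lemma sum_lossInd_le [NeZero m] {i : Fin K} (hi : i ≠ i₀) (hs : s i ≤ m) (a b : Fin K) :
    ∑ k : ZMod m, lossInd T s (σ + Pi.single i k) i a b ≤ s i * outInd T i a b := by
  classical
  have key : ∀ c b', T.out i c = b' →
      Finset.univ.filter (fun k : ZMod m => Loses T s (σ + Pi.single i k) i b') =
        Finset.univ.filter fun k : ZMod m => (c - σ i - k).val < s i := by
    intro c b' hc
    refine Finset.filter_congr fun k _ => ?_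
    simp only [Loses, Pi.add_apply, Pi.single_eq_same]
    constructor
    · rintro ⟨-, c', hc', h⟩
      rw [T.injective i hi (hc'.trans hc.symm)] at h
      rwa [sub_sub]
    · intro h
      exact ⟨hi, c, hc, by rwa [sub_sub] at h⟩
  rw [outInd]
  split_ifs with h
  · rw [mul_one]
    have hsum : ∀ c b', T.out i c = b' →
        (∑ k : ZMod m, if Loses T s (σ + Pi.single i k) i b' then (1 : ℝ) else 0) = s i := by
      intro c b' hc
      rw [Finset.sum_boole, key c b' hc, card_val_const_sub_lt _ hs]
    have hself : ∀ σ' : Fin K → ZMod m, ¬ Loses T s σ' i i := fun _ => not_loses_self i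
    rcases h with ⟨rfl, c, hc⟩ | ⟨rfl, c, hc⟩
    · refine le_of_eq (Eq.trans (Finset.sum_congr rfl fun k _ => ?_) (hsum c b hc))
      have : (a = a ∧ Loses T s (σ + Pi.single a k) a b ∨ b = a ∧ Loses T s (σ + Pi.single a k) a a) ↔
          Loses T s (σ + Pi.single a k) a b := by
        simp [hself]
      exact if_congr this rfl rfl
    · refine le_of_eq (Eq.trans (Finset.sum_congr rfl fun k _ => ?_) (hsum c a hc))
      have : (a = b ∧ Loses T s (σ + Pi.single b k) b b ∨ b = b ∧ Loses T s (σ + Pi.single b k) b a) ↔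
          Loses T s (σ + Pi.single b k) b a := by
        simp [hself]
      exact if_congr this rfl rfl
  · rw [mul_zero]
    refine le_of_eq (Finset.sum_eq_zero fun k _ => le_antisymm ?_ ?_)
    · have := lossInd_le_outInd (T := T) (s := s) (σ := σ + Pi.single i k) i a b
      rwa [outInd, if_neg h] at this
    · rw [lossInd]; split_ifs <;> norm_num

end Env

/-! ### The effective sparsity of the hard environments -/


section Sparsity

variable {K : ℕ} {i₀ : Fin K} {Δ Δ' : Matrix (Fin K) (Fin K) ℝ} {s t : Fin K → ℕ} {δ : ℝ}

lemma Hcertify_congr (h : ∀ i, i ≠ i₀ → orderedGap Δ i (s i) = orderedGap Δ' i (t i)) :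
    Hcertify Δ i₀ s δ = Hcertify Δ' i₀ t δ :=
  Finset.sum_congr rfl fun i _ => by rw [h i.1 i.2]

lemma Hexplore_congr (h : ∀ i, i ≠ i₀ → orderedGap Δ i (s i) = orderedGap Δ' i (s i)) :
    Hexplore Δ i₀ s δ = Hexplore Δ' i₀ s δ :=
  congrArg₂ (· + ·) (iSup_congr fun i => by rw [h i.1 i.2])
    (Finset.sum_congr rfl fun i _ => by rw [h i.1 i.2])

lemma Hexplore_nonneg (hL : 0 ≤ Real.log (1 / δ)) : 0 ≤ Hexplore Δ i₀ s δ :=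
  add_nonneg (Real.iSup_nonneg fun _ => by positivity)
    (Finset.sum_nonneg fun _ _ => by positivity)

/-- A single gap bounds the certification cost from below. -/
lemma le_Hcertify (hL : 0 ≤ Real.log (1 / δ)) {i : Fin K} (hi : i ≠ i₀) {ε : ℝ}
    (h : -ε ≤ orderedGap Δ i (s i)) (h' : orderedGap Δ i (s i) < 0) :
    Real.log (1 / δ) / ε ^ 2 ≤ Hcertify Δ i₀ s δ := by
  have h1 : Real.log (1 / δ) / ε ^ 2 ≤ Real.log (1 / δ) / orderedGap Δ i (s i) ^ 2 := by
    refine div_le_div_of_nonneg_left hL (sq_pos_iff.2 h'.ne) ?_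
    nlinarith
  exact h1.trans (Finset.single_le_sum
    (f := fun i : {i // i ≠ i₀} => Real.log (1 / δ) / orderedGap Δ i.1 (s i.1) ^ 2)
    (fun _ _ => by positivity) (Finset.mem_univ ⟨i, hi⟩))

/-- At fixed gaps, the exploration cost is strictly decreasing in the sparsity. -/
lemma Hexplore_lt (hL : 0 ≤ Real.log (1 / δ)) (hK : 0 < K)
    (hgap : ∀ i, i ≠ i₀ → orderedGap Δ i (t i) = orderedGap Δ i (s i))
    (hne : ∀ i, i ≠ i₀ → orderedGap Δ i (s i) ≠ 0) (ht : ∀ i, i ≠ i₀ → 1 ≤ t i)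
    (hts : ∀ i, i ≠ i₀ → t i ≤ s i) {i₁ : Fin K} (hi₁ : i₁ ≠ i₀) (hlt : t i₁ < s i₁) :
    Hexplore Δ i₀ s δ < Hexplore Δ i₀ t δ := by
  have hden : ∀ i, i ≠ i₀ → 0 < (t i : ℝ) * orderedGap Δ i (s i) ^ 2 := fun i hi =>
    mul_pos (by exact_mod_cast ht i hi) (sq_pos_iff.2 (hne i hi))
  have hle : ∀ i, i ≠ i₀ →
      (t i : ℝ) * orderedGap Δ i (s i) ^ 2 ≤ s i * orderedGap Δ i (s i) ^ 2 := fun i hi =>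
    mul_le_mul_of_nonneg_right (by exact_mod_cast hts i hi) (sq_nonneg _)
  have hK' : (0 : ℝ) < K := by exact_mod_cast hK
  refine add_lt_add_of_le_of_lt ?_ ?_
  · refine ciSup_mono (Set.finite_range _).bddAbove fun i => ?_
    rw [hgap i.1 i.2]
    exact div_le_div_of_nonneg_left (by positivity) (hden i.1 i.2) (hle i.1 i.2)
  · refine Finset.sum_lt_sum (fun i _ => ?_) ⟨⟨i₁, hi₁⟩, Finset.mem_univ _, ?_⟩
    · rw [hgap i.1 i.2]
      exact div_le_div_of_nonneg_left hK'.le (hden i.1 i.2) (hle i.1 i.2)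
    · rw [hgap i₁ hi₁]
      refine div_lt_div_of_pos_left hK' (hden i₁ hi₁) ?_
      exact mul_lt_mul_of_pos_right (by exact_mod_cast hlt) (sq_pos_iff.2 (hne i₁ hi₁))

end Sparsity

section LocalClass

variable {K m : ℕ} [NeZero m] {i₀ : Fin K} {T : Tournament m i₀} {s : Fin K → ℕ} {g : Fin K → ℝ}
  {ε : ℝ} {σ : Fin K → ZMod m}

lemma le_numNeg_env (hg : GapBounds i₀ g ε) {i : Fin K} (hi : i ≠ i₀) (hs : s i ≤ m) :
    s i ≤ numNeg (env T s g ε σ) i := by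
  rw [← ncard_loses (T := T) (σ := σ) hi hs]
  refine Set.ncard_le_ncard (fun j hj => ?_) (Set.toFinite _)
  change env T s g ε σ i j < 0
  rw [env_of_loses hj]
  linarith [hg.pos i hi]

lemma orderedGap_env_of_le (hg : GapBounds i₀ g ε) {i : Fin K} (hi : i ≠ i₀) (hs : s i ≤ m) {t : ℕ}
    (ht : 1 ≤ t) (hts : t ≤ s i) : orderedGap (env T s g ε σ) i t = -g i := by
  refine le_antisymm (orderedGap_le (fun j => (env_mem_Icc hg i j).1) ht (hts.trans ?_))
    (le_orderedGap ht (hts.trans (le_numNeg_env hg hi hs)) fun x hx => ?_)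
  · rw [← ncard_loses (T := T) (σ := σ) hi hs]
    exact Set.ncard_le_ncard (fun j hj => (env_of_loses hj).le) (Set.toFinite _)
  · have : {j | env T s g ε σ i j ≤ x} = ∅ := by
      refine Set.eq_empty_of_forall_notMem fun j (hj : env T s g ε σ i j ≤ x) => ?_
      have h1 := hg.eps_le_gap i hi
      have h2 := hg.eps_pos
      rw [env] at hj
      split_ifs at hj with h h' <;> try linarith
      linarith [hg.pos j h'.ne_left]
    rw [this, Set.ncard_empty]
    exact ht

lemma orderedGap_env_of_lt (hg : GapBounds i₀ g ε) {i : Fin K} (hi : i ≠ i₀) (hs : s i ≤ m) {t : ℕ}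
    (hst : s i < t) (ht : t ≤ numNeg (env T s g ε σ) i) : -ε ≤ orderedGap (env T s g ε σ) i t := by
  refine le_orderedGap (by omega) ht fun x hx => lt_of_le_of_lt ?_ hst
  rw [← ncard_loses (T := T) (σ := σ) hi hs]
  refine Set.ncard_le_ncard (fun j (hj : env T s g ε σ i j ≤ x) => ?_) (Set.toFinite _)
  have h2 := hg.eps_pos
  rw [env] at hj
  split_ifs at hj with h h' <;> first | exact h | exfalso
  · linarith [hg.pos j h'.ne_left]
  all_goals linarith

/-- The vector `s` is the only minimizer of the cost of `env`: a coordinate above `s i` brings in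
the tiny gap `ε`, and a coordinate below `s i` increases the exploration cost. -/
lemma eq_of_isOptimalSparsity_env {δ : ℝ} (hL : 0 < Real.log (1 / δ)) (hg : GapBounds i₀ g ε)
    (hs : ∀ i, i ≠ i₀ → s i ≤ m) (hs1 : ∀ i, i ≠ i₀ → 1 ≤ s i)
    (hsK : ∀ i, i ≠ i₀ → (s i : ℝ) ≤ (K : ℝ) / 8)
    (hε : Hcertify (env T s g ε σ) i₀ s δ + Hexplore (env T s g ε σ) i₀ s δ <
      Real.log (1 / δ) / ε ^ 2)
    {t : Fin K → ℕ} (ht : IsOptimalSparsity δ (env T s g ε σ) i₀ t) {i : Fin K} (hi : i ≠ i₀) :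
    t i = s i := by
  have hadm : IsAdmissible (env T s g ε σ) i₀ s := fun i hi =>
    ⟨hs1 i hi, le_numNeg_env hg hi (hs i hi), hsK i hi⟩
  have hopt := ht.2 s hadm
  have hle : ∀ i, i ≠ i₀ → t i ≤ s i := by
    intro i hi
    by_contra! hlt
    have h1 := le_Hcertify hL.le hi
      (orderedGap_env_of_lt hg hi (hs i hi) hlt (ht.1 i hi).2.1)
      (orderedGap_neg (fun j => (env_mem_Icc hg i j).1) (ht.1 i hi).1 (ht.1 i hi).2.1)
    have h2 := Hexplore_nonneg (Δ := env T s g ε σ) (i₀ := i₀) (s := t) hL.le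
    linarith
  by_contra hne
  have hgs : ∀ i, i ≠ i₀ → orderedGap (env T s g ε σ) i (s i) = -g i := fun i hi =>
    orderedGap_env_of_le hg hi (hs i hi) (hs1 i hi) le_rfl
  have hgap : ∀ i, i ≠ i₀ →
      orderedGap (env T s g ε σ) i (t i) = orderedGap (env T s g ε σ) i (s i) := fun i hi => by
    rw [hgs i hi, orderedGap_env_of_le hg hi (hs i hi) (ht.1 i hi).1 (hle i hi)]
  have h1 := Hexplore_lt hL.le i.pos hgap
    (fun i hi => by rw [hgs i hi]; exact neg_ne_zero.2 (hg.pos i hi).ne')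
    (fun i hi => (ht.1 i hi).1) hle hi (lt_of_le_of_ne (hle i hi) hne)
  have h2 := Hcertify_congr (δ := δ) hgap
  linarith

lemma env_mem_localClass {δ : ℝ} (hL : 0 < Real.log (1 / δ)) (hg : GapBounds i₀ g ε)
    {sStar : Matrix (Fin K) (Fin K) ℝ → Fin K → ℕ} (hsStar : IsEffectiveSparsity δ sStar)
    {Δ : Matrix (Fin K) (Fin K) ℝ} (hadm : IsAdmissible Δ i₀ (sStar Δ))
    (hgΔ : ∀ i, i ≠ i₀ → orderedGap Δ i (sStar Δ i) = -g i)
    (hs : ∀ i, i ≠ i₀ → sStar Δ i ≤ m)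
    (hε : Hcertify Δ i₀ (sStar Δ) δ + Hexplore Δ i₀ (sStar Δ) δ < Real.log (1 / δ) / ε ^ 2) :
    env T (sStar Δ) g ε σ ∈ localClass sStar Δ i₀ := by
  have hgs : ∀ i, i ≠ i₀ → orderedGap (env T (sStar Δ) g ε σ) i (sStar Δ i) =
      orderedGap Δ i (sStar Δ i) := fun i hi => by
    rw [orderedGap_env_of_le hg hi (hs i hi) (hadm i hi).1 le_rfl, hgΔ i hi]
  refine ⟨env_mem_Dcw hg, env_isCW hg, fun i hi => ?_, hgs⟩
  refine eq_of_isOptimalSparsity_env hL hg hs (fun i hi => (hadm i hi).1)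
    (fun i hi => (hadm i hi).2.2) ?_ (hsStar _ (env_mem_Dcw hg) i₀ (env_isCW hg)) hi
  rwa [Hcertify_congr hgs, Hexplore_congr hgs]

end LocalClass

/-! ### The three lower bounds on the budget -/


section Events

variable {K : ℕ} (A : Algorithm K) {δ : ℝ} {Δ : Matrix (Fin K) (Fin K) ℝ}

/-- The states in which the algorithm has recommended the arm `i`. -/
def recommended (i : Fin K) : Set (State K) := {x | x.output = some i}

lemma prob_recommended_le (hδ : 0 ≤ δ) (hA : A.IsCorrect δ) (hΔ : Δ ∈ Dcw K) {i j : Fin K}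
    (hi : IsCW Δ i) (hji : j ≠ i) (n : ℕ) : prob A Δ n (recommended j) ≤ δ := by
  rw [← ENNReal.ofReal_le_ofReal_iff hδ, ← law_apply_eq_prob]
  refine le_trans (measure_mono ?_) (hA Δ hΔ i hi)
  exact fun ω hω => ⟨j, hji, n, hω⟩

/-- If the budget is rarely as large as `θ`, then the Condorcet winner has been recommended at the
time `⌈θ⌉` with high probability. -/
lemma prob_compl_recommended_le (hδ : 0 < δ) (hA : A.IsCorrect δ) (hΔ : Δ ∈ Dcw K) {i : Fin K}
    (hi : IsCW Δ i) {θ : ℝ} (hθ : law A Δ {ω | ENNReal.ofReal θ ≤ ((budget ω : ℕ∞) : ℝ≥0∞)} <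
      ENNReal.ofReal δ) : prob A Δ ⌈θ⌉₊ (recommended i)ᶜ ≤ 2 * δ := by
  have h1 : prob A Δ ⌈θ⌉₊ {x | ⌈θ⌉₊ ≤ x.history.length} ≤ δ := by
    rw [← ENNReal.ofReal_le_ofReal_iff hδ.le, ← law_apply_eq_prob]
    refine le_trans (measure_mono ?_) hθ.le
    intro ω (hω : ⌈θ⌉₊ ≤ (ω ⌈θ⌉₊).history.length)
    have hb : ((⌈θ⌉₊ : ℕ) : ℕ∞) ≤ budget ω :=
      le_trans (by exact_mod_cast hω) (le_iSup (fun n => ((ω n).history.length : ℕ∞)) ⌈θ⌉₊)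
    have hb' : ((⌈θ⌉₊ : ℕ∞) : ℝ≥0∞) ≤ ((budget ω : ℕ∞) : ℝ≥0∞) := by exact_mod_cast hb
    refine le_trans ?_ hb'
    rw [ENat.toENNReal_coe, ← ENNReal.ofReal_natCast]
    exact ENNReal.ofReal_le_ofReal (Nat.le_ceil θ)
  have h2 : prob A Δ ⌈θ⌉₊ {x | ∃ j, j ≠ i ∧ x.output = some j} ≤ δ := by
    rw [← ENNReal.ofReal_le_ofReal_iff hδ.le, ← law_apply_eq_prob]
    refine le_trans (measure_mono ?_) (hA Δ hΔ i hi)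
    exact fun ω ⟨j, hj, hω⟩ => ⟨j, hj, _, hω⟩
  have h3 := prob_le_add A Δ ⌈θ⌉₊ (S := (recommended i)ᶜ)
    (T := {x | ⌈θ⌉₊ ≤ x.history.length}) (U := {x | ∃ j, j ≠ i ∧ x.output = some j})
    fun x hx hxi => by
      rcases ho : x.output with _ | j
      · exact Or.inl (hx.2 ho).ge
      · exact Or.inr ⟨j, fun hj => hxi (by rw [← hj]; exact ho), ho⟩
  linarith

lemma mean_le_of_le_mul_add (n : ℕ) {d e : Fin K → Fin K → ℝ} {C c : ℝ} (hc : 0 ≤ c)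
    (h : ∀ a b, d a b ≤ C * e a b + c) : mean A Δ n d ≤ C * mean A Δ n e + c * n := by
  have h1 := mean_mono A Δ n (d := d) (d' := C • e + fun _ _ => c) h
  rw [map_add, map_smul, smul_eq_mul] at h1
  have h2 := mean_le A Δ n hc (d := fun _ _ => c) fun _ _ => le_rfl
  linarith

end Events

lemma log_inv_ge {δ : ℝ} (hδ : 0 < δ) (hδ' : δ ≤ 1 / 12) : 242 / 100 ≤ Real.log (1 / δ) := by
  have h1 : Real.log 12 ≤ Real.log (1 / δ) := by
    refine Real.log_le_log (by norm_num) ?_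
    rw [le_div_iff₀ hδ]
    linarith
  -- `2 ^ 7 ≤ 12 ^ 2`
  have h2 : 7 * Real.log 2 ≤ 2 * Real.log 12 := by
    have h := Real.log_le_log (by norm_num) (show (2 : ℝ) ^ 7 ≤ 12 ^ 2 by norm_num)
    rw [Real.log_pow, Real.log_pow] at h
    exact_mod_cast h
  have := Real.log_two_gt_d9
  linarith

open Filter Topology in
/-- All the smallness conditions on the margin of the Condorcet winner can be met at once. -/
lemma exists_margin {K : ℕ} {i₀ : Fin K} {g : Fin K → ℝ} (hg0 : ∀ i, i ≠ i₀ → 0 < g i)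
    (hg1 : ∀ i, i ≠ i₀ → g i ≤ 1 / 4) {L : ℝ} (hL : 0 < L) (H : ℝ) (B : ℕ) :
    ∃ ε, GapBounds i₀ g ε ∧ H < L / ε ^ 2 ∧ 64 / 3 * ε ^ 2 * B ≤ 1 / 200 := by
  have hle : ∀ c : ℝ, 0 < c → ∀ᶠ ε in 𝓝[>] (0 : ℝ), ε ≤ c := fun c hc =>
    nhdsWithin_le_nhds (eventually_le_nhds hc)
  have hsq : ∀ C c : ℝ, 0 < c → ∀ᶠ ε in 𝓝[>] (0 : ℝ), C * ε ^ 2 < c := by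
    intro C c hc
    have : Tendsto (fun ε : ℝ => C * ε ^ 2) (𝓝 0) (𝓝 (C * 0 ^ 2)) :=
      (Continuous.tendsto (by fun_prop) 0)
    exact nhdsWithin_le_nhds (this.eventually_lt_const (by simpa using hc))
  have hgap : ∀ᶠ ε in 𝓝[>] (0 : ℝ), ∀ i, i ≠ i₀ → ε ≤ g i := by
    refine eventually_all.2 fun i => ?_
    by_cases hi : i = i₀
    · simp [hi]
    · filter_upwards [hle _ (hg0 i hi)] with ε h _ using h
  obtain ⟨ε, hε, h1, h2, h3, h4⟩ := (eventually_mem_nhdsWithin.and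
    ((hle (1 / 4) (by norm_num)).and (hgap.and ((hsq H L hL).and
      (hsq (64 / 3 * B) (1 / 200) (by norm_num)))))).exists
  have hε : 0 < ε := hε
  exact ⟨ε, ⟨hg0, hg1, hε, h1, h2⟩, by rwa [lt_div_iff₀ (by positivity)], by linarith⟩

section LowerBounds

variable {K m : ℕ} {i₀ : Fin K} {T : Tournament m i₀} {s : Fin K → ℕ} {g : Fin K → ℝ}
  {ε δ : ℝ} {A : Algorithm K} {B : ℕ}

/-- The number of duels needed to certify that the arm `i` is not the Condorcet winner. -/
lemma log_div_sq_le_mean (hδ : 0 < δ) (hδ' : δ ≤ 1 / 12) (hA : A.IsCorrect δ)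
    (hg : GapBounds i₀ g ε) (hε : 64 / 3 * ε ^ 2 * B ≤ 1 / 200) (σ : Fin K → ZMod m)
    (hσ : prob A (env T s g ε σ) B (recommended i₀)ᶜ ≤ 2 * δ) {i : Fin K} (hi : i ≠ i₀) :
    Real.log (1 / δ) / g i ^ 2 ≤ 28 * mean A (env T s g ε σ) B (outInd T i) := by
  have hL := log_inv_ge hδ hδ'
  have hgi := hg.pos i hi
  have h1 := prob_mul_log_le A (env_mem_Icc hg) (altEnv_mem_Icc hg i) B (recommended i₀)
    (Δ₁ := env T s g ε σ) (Δ₂ := altEnv T s g ε σ i) (r := 1 / δ)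
    (by rw [le_div_iff₀ hδ]; linarith)
  have h2 := prob_recommended_le A hδ.le hA (altEnv_mem_Dcw (T := T) (s := s) (σ := σ) hg i)
    (altEnv_isCW hg i) hi.symm B
  have h3 : (1 / δ - 1) * prob A (altEnv T s g ε σ i) B (recommended i₀) ≤ 1 := by
    refine (mul_le_mul_of_nonneg_left h2 ?_).trans ?_
    · rw [sub_nonneg, le_div_iff₀ hδ]; linarith
    · rw [sub_mul, div_mul_cancel₀ _ hδ.ne']; linarith
  have h4 := mean_le_of_le_mul_add A (Δ := env T s g ε σ) B (C := 32 / 3 * g i ^ 2)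
    (c := 64 / 3 * ε ^ 2) (e := outInd T i) (by positivity) fun a b =>
    (duelCost_env_le (T := T) (s := s) (σ := σ) hg hi a b).trans
      (add_le_add_left (mul_le_mul_of_nonneg_left (lossInd_le_outInd i a b) (by positivity)) _)
  rw [prob_compl] at hσ
  have h5 : 5 / 6 * Real.log (1 / δ) ≤
      prob A (env T s g ε σ) B (recommended i₀) * Real.log (1 / δ) :=
    mul_le_mul_of_nonneg_right (by linarith) (by linarith)
  rw [div_le_iff₀ (by positivity)]
  linarith

/-- The cost of telling apart `altEnv` from the environments in which the arms against which `i`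
loses are shifted cyclically: on average over the shifts, a duel finds out only with probability
`s i / m`. -/
lemma sum_mean_duelCost_le [NeZero m] (hg : GapBounds i₀ g ε) {i : Fin K} (hi : i ≠ i₀) (hs : s i ≤ m)
    (hε : 64 / 3 * ε ^ 2 * B ≤ 1 / 200) (σ : Fin K → ZMod m) (A : Algorithm K) :
    ∑ k : ZMod m, mean A (altEnv T s g ε σ i) B
        (duelCost (altEnv T s g ε σ i) (env T s g ε (σ + Pi.single i k))) ≤
      32 / 3 * g i ^ 2 * (s i * mean A (altEnv T s g ε σ i) B (outInd T i)) + m * (1 / 200) := by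
  have h1 : ∀ k : ZMod m, mean A (altEnv T s g ε σ i) B
      (duelCost (altEnv T s g ε σ i) (env T s g ε (σ + Pi.single i k))) ≤
      32 / 3 * g i ^ 2 * mean A (altEnv T s g ε σ i) B (lossInd T s (σ + Pi.single i k) i) +
        1 / 200 := by
    intro k
    have hk : altEnv T s g ε σ i = altEnv T s g ε (σ + Pi.single i k) i :=
      altEnv_congr fun j hj => by simp [hj]
    have hd := duelCost_env_le (T := T) (s := s) (σ := σ + Pi.single i k) hg hi
    rw [duelCost_comm, ← hk] at hd
    have h := mean_le_of_le_mul_add A (Δ := altEnv T s g ε σ i) B (by positivity) hd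
    linarith
  refine (Finset.sum_le_sum fun k _ => h1 k).trans ?_
  rw [Finset.sum_add_distrib, ← Finset.mul_sum, ← map_sum, Finset.sum_const, Finset.card_univ,
    ZMod.card, nsmul_eq_mul]
  gcongr
  rw [← smul_eq_mul, ← map_smul]
  refine mean_mono _ _ _ fun a b => ?_
  rw [Finset.sum_apply, Finset.sum_apply]
  exact sum_lossInd_le hi hs a b

/-- The number of duels needed to find, with probability `1 - δ`, an arm against which `i` loses. -/
lemma explore_log_le [NeZero m] (hδ : 0 < δ) (hδ' : δ ≤ 1 / 12) (hA : A.IsCorrect δ)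
    (hg : GapBounds i₀ g ε) (hε : 64 / 3 * ε ^ 2 * B ≤ 1 / 200)
    (hσ : ∀ σ, prob A (env T s g ε σ) B (recommended i₀)ᶜ ≤ 2 * δ) (hK : (K : ℝ) / 4 ≤ m)
    {i : Fin K} (hi : i ≠ i₀) (hs : s i ≤ m) (hs1 : 1 ≤ s i) :
    K * Real.log (1 / δ) / (s i * g i ^ 2) ≤ 220 * B := by
  have hL := log_inv_ge hδ hδ'
  have hgi := hg.pos i hi
  have hsi : (0 : ℝ) < s i := by exact_mod_cast hs1
  have h2 := Real.log_two_lt_d9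
  set σ : Fin K → ZMod m := 0
  have hk : ∀ k : ZMod m, Real.log (1 / δ) / 5 ≤ mean A (altEnv T s g ε σ i) B
      (duelCost (altEnv T s g ε σ i) (env T s g ε (σ + Pi.single i k))) := by
    intro k
    have h1 := prob_mul_log_le A (altEnv_mem_Icc hg i) (env_mem_Icc hg) B (recommended i₀)ᶜ
      (Δ₁ := altEnv T s g ε σ i) (Δ₂ := env T s g ε (σ + Pi.single i k)) (r := 1 / (2 * δ))
      (by rw [le_div_iff₀ (by positivity)]; linarith)
    have h3 : (1 / (2 * δ) - 1) * prob A (env T s g ε (σ + Pi.single i k)) B (recommended i₀)ᶜ ≤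
        1 := by
      refine (mul_le_mul_of_nonneg_left (hσ _) ?_).trans ?_
      · rw [sub_nonneg, le_div_iff₀ (by positivity)]; linarith
      · rw [sub_mul, div_mul_cancel₀ _ (by positivity)]; linarith
    have h4 := prob_recommended_le A hδ.le hA (altEnv_mem_Dcw (T := T) (s := s) (σ := σ) hg i)
      (altEnv_isCW hg i) hi.symm B
    have h5 : Real.log (1 / (2 * δ)) = Real.log (1 / δ) - Real.log 2 := by
      rw [← Real.log_div (by positivity) (by norm_num)]
      congr 1
      field_simp
    rw [h5, prob_compl] at h1
    have h6 : 11 / 12 * (Real.log (1 / δ) - Real.log 2) ≤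
        (1 - prob A (altEnv T s g ε σ i) B (recommended i₀)) *
          (Real.log (1 / δ) - Real.log 2) :=
      mul_le_mul_of_nonneg_right (by linarith) (by linarith)
    linarith
  have h3 := (Finset.sum_le_sum fun k _ => hk k).trans
    (sum_mean_duelCost_le (T := T) hg hi hs hε σ A)
  rw [Finset.sum_const, Finset.card_univ, ZMod.card, nsmul_eq_mul] at h3
  have h4 := mean_le A (altEnv T s g ε σ i) B zero_le_one (outInd_le_one (T := T) i)
  have h5 : 32 / 3 * g i ^ 2 * (s i * mean A (altEnv T s g ε σ i) B (outInd T i)) ≤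
      32 / 3 * g i ^ 2 * (s i * B) := by
    gcongr
    linarith
  have h6 : K / 4 * (Real.log (1 / δ) / 5 - 1 / 200) ≤ m * (Real.log (1 / δ) / 5 - 1 / 200) :=
    mul_le_mul_of_nonneg_right hK (by linarith)
  have h7 : (K : ℝ) * (39 / 200 * Real.log (1 / δ)) ≤
      K * (Real.log (1 / δ) / 5 - 1 / 200) :=
    mul_le_mul_of_nonneg_left (by linarith) (Nat.cast_nonneg K)
  rw [div_le_iff₀ (by positivity)]
  have h8 : 0 ≤ (s i : ℝ) * g i ^ 2 * B := by positivity
  nlinarith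

/-- The number of duels involving the arm `i`, in the environment `env` with a random shift, which
are needed to find with constant probability an arm against which `i` loses. -/
lemma sum_prob_lt_weight_ge [NeZero m] (hδ : 0 < δ) (hδ' : δ ≤ 1 / 12) (hA : A.IsCorrect δ)
    (hg : GapBounds i₀ g ε) (hε : 64 / 3 * ε ^ 2 * B ≤ 1 / 200)
    (hσ : ∀ σ, prob A (env T s g ε σ) B (recommended i₀)ᶜ ≤ 2 * δ)
    {i : Fin K} (hi : i ≠ i₀) (hs : s i ≤ m) (hs1 : 1 ≤ s i) (σ : Fin K → ZMod m) :
    (m : ℝ) / 10 ≤ ∑ k : ZMod m, prob A (env T s g ε (σ + Pi.single i k)) B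
      {x | (m : ℝ) / (24 * (s i * g i ^ 2)) - 1 < weight (outInd T i) x.history} := by
  have hgi := hg.pos i hi
  have hsi : (0 : ℝ) < s i := by exact_mod_cast hs1
  -- the constant 24 keeps the relative entropy accumulated by the truncated algorithm below `m / 2`
  set y : ℝ := m / (24 * (s i * g i ^ 2)) with hy
  have hy0 : 0 ≤ y := by positivity
  set S₁ : Set (State K) := {x | y - 1 < weight (outInd T i) x.history} with hS₁
  set A' := truncate A i₀ (outInd T i) y
  have htr : ∀ Δ, prob A' Δ B (S₁ ∪ (recommended i₀)ᶜ) = prob A Δ B (S₁ ∪ (recommended i₀)ᶜ) :=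
    fun Δ => prob_truncate A i₀ (outInd_nonneg i) Δ B fun x hx => Or.inl hx
  have hk : ∀ k : ZMod m, 77 / 100 ≤ mean A' (altEnv T s g ε σ i) B
      (duelCost (altEnv T s g ε σ i) (env T s g ε (σ + Pi.single i k))) +
      3 * prob A (env T s g ε (σ + Pi.single i k)) B S₁ := by
    intro k
    have h1 := prob_mul_log_le A' (altEnv_mem_Icc hg i) (env_mem_Icc hg) B
      (S₁ ∪ (recommended i₀)ᶜ)
      (Δ₁ := altEnv T s g ε σ i) (Δ₂ := env T s g ε (σ + Pi.single i k)) (r := 4) (by norm_num)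
    rw [htr, htr] at h1
    have h2 := prob_le_add A (env T s g ε (σ + Pi.single i k)) B
      (S := S₁ ∪ (recommended i₀)ᶜ) (T := S₁) (U := (recommended i₀)ᶜ) fun x _ hx => hx
    have h3 := hσ (σ + Pi.single i k)
    have h4 := prob_recommended_le A hδ.le hA (altEnv_mem_Dcw (T := T) (s := s) (σ := σ) hg i)
      (altEnv_isCW hg i) hi.symm B
    have h5 := prob_mono A (altEnv T s g ε σ i) B
      (Set.subset_union_right (s := S₁) (t := (recommended i₀)ᶜ))
    rw [prob_compl] at h5
    have h6 : Real.log 4 = 2 * Real.log 2 := by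
      rw [show (4 : ℝ) = 2 ^ 2 by norm_num, Real.log_pow]
      norm_num
    have h7 := Real.log_two_gt_d9
    have h8 : 11 / 12 * Real.log 4 ≤
        prob A (altEnv T s g ε σ i) B (S₁ ∪ (recommended i₀)ᶜ) * Real.log 4 :=
      mul_le_mul_of_nonneg_right (by linarith) (by linarith)
    linarith
  have h1 := Finset.sum_le_sum fun (k : ZMod m) (_ : k ∈ Finset.univ) => hk k
  rw [Finset.sum_const, Finset.card_univ, ZMod.card, nsmul_eq_mul, Finset.sum_add_distrib,
    ← Finset.mul_sum] at h1
  have h2 := sum_mean_duelCost_le (T := T) hg hi hs hε σ A'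
  have h3 := mean_truncate_le A i₀ (outInd_le_one (T := T) i) hy0 (altEnv T s g ε σ i) B
  have h4 : 32 / 3 * g i ^ 2 * (s i * mean A' (altEnv T s g ε σ i) B (outInd T i)) ≤
      32 / 3 * g i ^ 2 * (s i * y) := by gcongr
  have h5 : 32 / 3 * g i ^ 2 * (s i * y) = 4 / 9 * m := by
    rw [hy]
    field_simp
    ring
  have hm : (0 : ℝ) ≤ m := Nat.cast_nonneg m
  linarith

/-- The total number of duels needed to find, for each arm, an opponent which beats it. For a
random choice of the shifts, all the arms require many duels at once. -/
lemma explore_sum_le [NeZero m] (hδ : 0 < δ) (hδ' : δ ≤ 1 / 12) (hA : A.IsCorrect δ)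
    (hg : GapBounds i₀ g ε) (hε : 64 / 3 * ε ^ 2 * B ≤ 1 / 200)
    (hσ : ∀ σ, prob A (env T s g ε σ) B (recommended i₀)ᶜ ≤ 2 * δ) (hK : (K : ℝ) / 4 ≤ m)
    (hs : ∀ i, i ≠ i₀ → 3 * s i ≤ m) (hs1 : ∀ i, i ≠ i₀ → 1 ≤ s i) :
    ∑ i : {i : Fin K // i ≠ i₀}, (K : ℝ) / (s i * g i ^ 2) ≤ 1920 * B := by
  set y : {i : Fin K // i ≠ i₀} → ℝ := fun i => m / (24 * (s i * g i ^ 2)) with hy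
  set S : {i : Fin K // i ≠ i₀} → Set (State K) := fun i =>
    {x | y i - 1 < weight (outInd T i.1) x.history} with hS
  have hpos : ∀ i : {i : Fin K // i ≠ i₀}, (0 : ℝ) < s i * g i ^ 2 := fun i =>
    mul_pos (by exact_mod_cast hs1 i.1 i.2) (pow_pos (hg.pos i.1 i.2) 2)
  have hy2 : ∀ i, 2 ≤ y i := by
    intro i
    have h1 := hpos i
    have h2 : (3 : ℝ) * s i ≤ m := by exact_mod_cast hs i.1 i.2
    have h3 : g i ^ 2 ≤ 1 / 16 := by nlinarith [hg.pos i.1 i.2, hg.le i.1 i.2]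
    have h4 : (s i : ℝ) * g i ^ 2 ≤ s i * (1 / 16) :=
      mul_le_mul_of_nonneg_left h3 (Nat.cast_nonneg _)
    simp only [hy]
    rw [le_div_iff₀ (by positivity)]
    linarith
  have h1 : ∀ σ : Fin K → ZMod m,
      ∑ i, y i / 2 * prob A (env T s g ε σ) B (S i) ≤ B := by
    intro σ
    refine (sum_mul_prob_le_mean A (env T s g ε σ) Finset.univ B (fun i => outInd T i.1)
      (fun i => y i / 2) S (fun i _ => outInd_nonneg i.1) fun i _ x hx => ?_).trans ?_
    · have hx' : y i - 1 < weight (outInd T i.1) x.history := hx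
      linarith [hy2 i]
    · have := mean_le A (env T s g ε σ) B zero_le_one
        (d := ∑ i : {i : Fin K // i ≠ i₀}, outInd T i.1) fun a b => by
          rw [Finset.sum_apply, Finset.sum_apply]
          exact sum_outInd_le a b
      linarith
  set N : ℝ := ((Fintype.card (Fin K → ZMod m) : ℕ) : ℝ) with hN
  have hN0 : 0 < N := by
    rw [hN]
    exact_mod_cast Fintype.card_pos
  have hm0 : (0 : ℝ) < m := by exact_mod_cast Nat.pos_of_neZero m
  have h2 : ∀ i, N / 10 ≤ ∑ σ : Fin K → ZMod m, prob A (env T s g ε σ) B (S i) := by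
    intro i
    -- the sum over `σ` is invariant under each of the `m` shifts of the coordinate `i`
    have h3 : ∑ σ : Fin K → ZMod m, ∑ k : ZMod m,
        prob A (env T s g ε (σ + Pi.single i.1 k)) B (S i) =
        m * ∑ σ : Fin K → ZMod m, prob A (env T s g ε σ) B (S i) := by
      rw [Finset.sum_comm]
      have h4 : ∀ k : ZMod m, ∑ σ : Fin K → ZMod m,
          prob A (env T s g ε (σ + Pi.single i.1 k)) B (S i) =
          ∑ σ : Fin K → ZMod m, prob A (env T s g ε σ) B (S i) := fun k =>
        Equiv.sum_comp (Equiv.addRight (Pi.single i.1 k : Fin K → ZMod m))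
          fun σ => prob A (env T s g ε σ) B (S i)
      simp only [h4, Finset.sum_const, Finset.card_univ, ZMod.card, nsmul_eq_mul]
    have h5 := Finset.sum_le_sum fun (σ : Fin K → ZMod m) (_ : σ ∈ Finset.univ) =>
      sum_prob_lt_weight_ge hδ hδ' hA hg hε hσ i.2 (by have := hs i.1 i.2; omega)
        (hs1 i.1 i.2) σ
    rw [Finset.sum_const, Finset.card_univ, nsmul_eq_mul, h3, ← hN] at h5
    refine le_of_mul_le_mul_left ?_ hm0
    linarith
  have h3 : N * ∑ i, y i / 20 ≤ N * B := by
    calc N * ∑ i, y i / 20 = ∑ i, y i / 2 * (N / 10) := by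
          rw [Finset.mul_sum]
          exact Finset.sum_congr rfl fun i _ => by ring
      _ ≤ ∑ i, y i / 2 * ∑ σ : Fin K → ZMod m, prob A (env T s g ε σ) B (S i) :=
          Finset.sum_le_sum fun i _ =>
            mul_le_mul_of_nonneg_left (h2 i) (by linarith [hy2 i])
      _ = ∑ σ : Fin K → ZMod m, ∑ i, y i / 2 * prob A (env T s g ε σ) B (S i) := by
          rw [Finset.sum_comm]
          exact Finset.sum_congr rfl fun i _ => Finset.mul_sum _ _ _
      _ ≤ ∑ _σ : Fin K → ZMod m, (B : ℝ) := Finset.sum_le_sum fun σ _ => h1 σ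
      _ = N * B := by rw [Finset.sum_const, Finset.card_univ, nsmul_eq_mul]
  have h4 := le_of_mul_le_mul_left h3 hN0
  rw [← Finset.sum_div] at h4
  have h5 : ∑ i : {i : Fin K // i ≠ i₀}, (K : ℝ) / (s i * g i ^ 2) ≤ ∑ i, 96 * y i := by
    refine Finset.sum_le_sum fun i _ => ?_
    have h6 : 96 * y i = 4 * m / (s i * g i ^ 2) := by
      have := (hpos i).ne'
      simp only [hy]
      field_simp
      norm_num
    rw [h6]
    exact div_le_div_of_nonneg_right (by linarith) (hpos i).le
  rw [← Finset.mul_sum] at h5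
  linarith

end LowerBounds

/-- The lower bound, with an explicit constant. -/
lemma exists_localClass_law_budget_ge {K : ℕ} (hK : 8 ≤ K) {δ : ℝ} (hδ : 0 < δ) (hδ' : δ ≤ 1 / 12)
    {sStar : Matrix (Fin K) (Fin K) ℝ → Fin K → ℕ} (hsStar : IsEffectiveSparsity δ sStar)
    {A : Algorithm K} (hA : A.IsCorrect δ) {Δ : Matrix (Fin K) (Fin K) ℝ} (hΔ : Δ ∈ Dcw K)
    {i₀ : Fin K} (hi₀ : IsCW Δ i₀) :
    ∃ Δ' ∈ localClass sStar Δ i₀, ENNReal.ofReal δ ≤ law A Δ'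
      {ω | ENNReal.ofReal (1 / 5000 / Real.log K *
        (Hcertify Δ i₀ (sStar Δ) δ + Hexplore Δ i₀ (sStar Δ) δ)) ≤
          ((budget ω : ℕ∞) : ℝ≥0∞)} := by
  set s := sStar Δ with hs
  set H := Hcertify Δ i₀ s δ + Hexplore Δ i₀ s δ with hH
  set θ := 1 / 5000 / Real.log K * H with hθ
  set B := ⌈θ⌉₊ with hB
  have hL := log_inv_ge hδ hδ'
  have hL0 : 0 < Real.log (1 / δ) := by linarith
  have hadm := (hsStar Δ hΔ i₀ hi₀).1
  have hrow : ∀ i j, -(1 / 4) ≤ Δ i j := fun i j => (hΔ.1 i j).1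
  set g : Fin K → ℝ := fun i => -orderedGap Δ i (s i) with hg
  have hg0 : ∀ i, i ≠ i₀ → 0 < g i := fun i hi =>
    neg_pos.2 (orderedGap_neg (hrow i) (hadm i hi).1 (hadm i hi).2.1)
  have hg1 : ∀ i, i ≠ i₀ → -(1 / 4) ≤ orderedGap Δ i (s i) := fun i hi =>
    le_orderedGap (hadm i hi).1 (hadm i hi).2.1 fun x hx => by
      have : {j | Δ i j ≤ x} = ∅ :=
        Set.eq_empty_of_forall_notMem fun j (hj : Δ i j ≤ x) => by linarith [hrow i j]
      rw [this, Set.ncard_empty]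
      exact (hadm i hi).1
  -- the tiny margin of the Condorcet winner
  obtain ⟨ε, hgb, hεH, hεB⟩ : ∃ ε, GapBounds i₀ g ε ∧ H < Real.log (1 / δ) / ε ^ 2 ∧
      64 / 3 * ε ^ 2 * B ≤ 1 / 200 :=
    exists_margin hg0 (fun i hi => by have := hg1 i hi; simp only [hg]; linarith) hL0 H B
  set m := (K - 2) / 2 with hm
  have : NeZero m := ⟨by omega⟩
  obtain ⟨T⟩ := exists_tournament (m := m) (K := K) (by omega) i₀
  have hs1 : ∀ i, i ≠ i₀ → 1 ≤ s i := fun i hi => (hadm i hi).1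
  have hs3 : ∀ i, i ≠ i₀ → 3 * s i ≤ m := by
    intro i hi
    have h1 : 8 * s i ≤ K := by
      have := (hadm i hi).2.2
      have : (8 : ℝ) * s i ≤ K := by linarith
      exact_mod_cast this
    omega
  have hsm : ∀ i, i ≠ i₀ → s i ≤ m := fun i hi => by have := hs3 i hi; omega
  have hKm : (K : ℝ) / 4 ≤ m := by
    have : K ≤ 4 * m := by omega
    have : (K : ℝ) ≤ 4 * m := by exact_mod_cast this
    linarith
  by_contra! hcon
  have hσ : ∀ σ, prob A (env T s g ε σ) B (recommended i₀)ᶜ ≤ 2 * δ := fun σ =>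
    prob_compl_recommended_le A hδ hA (env_mem_Dcw hgb) (env_isCW hgb)
      (hcon _ (env_mem_localClass hL0 hgb hsStar hadm (fun i _ => (neg_neg _).symm) hsm hεH))
  have hcert : Hcertify Δ i₀ s δ ≤ 28 * B := by
    have h1 : Hcertify Δ i₀ s δ ≤ ∑ i : {i : Fin K // i ≠ i₀},
        28 * mean A (env T s g ε 0) B (outInd T i.1) := by
      refine Finset.sum_le_sum fun i _ => ?_
      have := log_div_sq_le_mean hδ hδ' hA hgb hεB (0 : Fin K → ZMod m) (hσ 0) i.2
      simpa only [hg, neg_sq] using this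
    rw [← Finset.mul_sum, ← map_sum] at h1
    have h2 := mean_le A (env T s g ε 0) B zero_le_one
      (d := ∑ i : {i : Fin K // i ≠ i₀}, outInd T i.1) fun a b => by
        rw [Finset.sum_apply, Finset.sum_apply]
        exact sum_outInd_le a b
    linarith
  have hexpl : Hexplore Δ i₀ s δ ≤ 220 * B + 1920 * B := by
    refine add_le_add (Real.iSup_le (fun i => ?_) (by positivity)) ?_
    · simpa only [hg, neg_sq] using
        explore_log_le hδ hδ' hA hgb hεB hσ hKm i.2 (hsm i.1 i.2) (hs1 i.1 i.2)
    · simpa only [hg, neg_sq] using explore_sum_le hδ hδ' hA hgb hεB hσ hKm hs3 hs1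
  have hlogK : 1 ≤ Real.log K := by
    rw [Real.le_log_iff_exp_le (by positivity)]
    have : (8 : ℝ) ≤ K := by exact_mod_cast hK
    linarith [Real.exp_one_lt_d9]
  -- a single arm makes the certification cost large enough for the rounding of `θ` not to matter
  have hB2 : 2 ≤ B := by
    have : Nontrivial (Fin K) := Fin.nontrivial_iff_two_le.2 (by omega)
    obtain ⟨i, hi⟩ := exists_ne i₀
    have h1 := le_Hcertify (δ := δ) hL0.le hi (hg1 i hi) (neg_pos.1 (hg0 i hi))
    by_contra! hlt
    have h2 : (B : ℝ) ≤ 1 := by exact_mod_cast Nat.le_of_lt_succ hlt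
    norm_num at h1
    norm_num at hL
    linarith
  have hH0 : 0 ≤ H :=
    add_nonneg (Finset.sum_nonneg fun _ _ => by positivity) (Hexplore_nonneg hL0.le)
  have hθH : θ ≤ 1 / 5000 * H := by
    refine mul_le_mul_of_nonneg_right ?_ hH0
    exact div_le_self (by norm_num) hlogK
  have hθ0 : 0 ≤ θ := by positivity
  have hBθ : (B : ℝ) < θ + 1 := Nat.ceil_lt_add_one hθ0
  have hB2' : (2 : ℝ) ≤ B := by exact_mod_cast hB2
  linarith

end CondorcetWinner

theorem corollary5 :
    ∃ c : ℝ, 0 < c ∧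
      ∀ K : ℕ, 8 ≤ K →
      ∀ δ : ℝ, 0 < δ → δ ≤ 1 / 12 →
      ∀ sStar : Matrix (Fin K) (Fin K) ℝ → Fin K → ℕ,
        CondorcetWinner.IsEffectiveSparsity δ sStar →
      ∀ A : CondorcetWinner.Algorithm K, A.IsCorrect δ →
      ∀ Δ ∈ CondorcetWinner.Dcw K, ∀ i₀ : Fin K, CondorcetWinner.IsCW Δ i₀ →
        ∃ Δ' ∈ CondorcetWinner.localClass sStar Δ i₀,
          ENNReal.ofReal δ ≤ CondorcetWinner.law A Δ'
            {ω | ENNReal.ofReal (c / Real.log K *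
                (CondorcetWinner.Hcertify Δ i₀ (sStar Δ) δ +
                  CondorcetWinner.Hexplore Δ i₀ (sStar Δ) δ)) ≤
              ((CondorcetWinner.budget ω : ℕ∞) : ℝ≥0∞)} :=
  ⟨1 / 5000, by norm_num, fun _ hK _ hδ hδ' _ hsStar _ hA _ hΔ _ hi₀ =>
    CondorcetWinner.exists_localClass_law_budget_ge hK hδ hδ' hsStar hA hΔ hi₀⟩
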